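/- Let $X$ be a locally compact Hausdorff space. Let $\mathscr O(Y),\mathscr C(Y),\mathscr K(Y)$ denote the open, closed and compact subsets of a space $Y$. For a locally compact Hausdorff space $Y$, a finite deficient topological measure on $Y$ is a function $\nu:\mathscr O(Y)\cup\mathscr C(Y)\to[0,\infty]$ with $\nu(Y)<\infty$ such that $\nu(C\sqcup K)=\nu(C)+\nu(K)$ for disjoint compact $C,K$; $\nu(U)=\sup\{\nu(K): K\subseteq U,\ K\in\mathscr K(Y)\}$ for $U$ open; and $\nu(F)=\inf\{\nu(U): F\subseteq U,\ U\in\mathscr O(Y)\}$ for $F$ closed. It is a topological measure if moreover $\nu(A\sqcup B)=\nu(A)+\nu(B)$ whenever $A,B$ are disjoint and $A,B,A\sqcup B\in\mathscr K(Y)\cup\mathscr O(Y)$. It is proper if the only Radon measure $m$ with $m\le\nu$ on $\mathscr O(Y)\cup\mathscr C(Y)$ is $m=0$. Let $\mathbf{DTM}(Y)\supseteq\mathbf{TM}(Y)\supseteq\mathbf M(Y)$ be the sets of finite deficient topological measures, of finite topological measures, and of restrictions to $\mathscr O(Y)\cup\mathscr C(Y)$ of finite Radon measures, and let $p\mathbf{DTM}(Y)$,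 $p\mathbf{TM}(Y)$ be the sets of proper elements of $\mathbf{DTM}(Y)$, $\mathbf{TM}(Y)$. Give $\mathbf{DTM}(Y)$ the weak topology, the coarsest one for which $\mu\mapsto\int_Y f\,d\mu=\int_0^{\|f\|}\mu(\{y: f(y)>t\})\,dt$ is continuous for every $f\in C_0(Y)$ with $f\ge 0$. A set $\mathcal Y\subseteq\mathbf{DTM}(Y)$ is called dense in $\mathcal Z\subseteq\mathbf{DTM}(Y)$ if $\mathcal Z\subseteq\overline{\mathcal Y}$. Suppose $X=\bigcup_{i=1}^\infty X_i$, where the subsets $X_i$ carry the subspace topology. (1) Let each $X_i$ be compact. If $p\mathbf{DTM}(X_i)$ is dense in $\mathbf M(X_i)$ for every $i$, then $p\mathbf{DTM}(X)$ is dense in $\mathbf M(X)$. (2) Let each $X_i$ be compact. If $p\mathbf{TM}(X_i)$ is dense in $\mathbf M(X_i)$ for every $i$, then $p\mathbf{TM}(X)$ is dense in $\mathbf M(X)$. (3) Let each $X_i$ be a closed (for example, compact) subset of $X$ that is, as a space, connected, locally connected, locally compact, has more than one point, has no cut points, and whose Aleksandrov one-point compactification ($X_i$ itself if $X_i$ is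 compact) has genus $0$. Here a compact space has genus $0$ if the complement of any finite union of pairwise disjoint closed solid sets is connected, a set being solid if it and its complement are connected (the empty set counts as connected). Then $p\mathbf{TM}(X)$ is dense in $\mathbf{TM}(X)$, and $p\mathbf{DTM}(X)$ is dense in $\mathbf{DTM}(X)$. -/

import Mathlib

open Set TopologicalSpace MeasureTheory Topology
open scoped ENNReal ZeroAtInfty

noncomputable section

/-- The family of all subsets of `X` that are open or closed: the domain of the set functions
considered here. -/
abbrev OCSet (X : Type*) [TopologicalSpace X] : Type _ :=
  {A : Set X // IsOpen A ∨ IsClosed A}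

namespace OCSet

variable {X : Type*} [TopologicalSpace X]

/-- An open set, as a member of the family. -/
def ofOpen (U : Opens X) : OCSet X := ⟨U, Or.inl U.isOpen⟩

/-- A closed set, as a member of the family. -/
def ofClosed (F : Closeds X) : OCSet X := ⟨F, Or.inr F.isClosed⟩

/-- A compact subset of a Hausdorff space, as a member of the family. -/
def ofCompact [T2Space X] (K : Compacts X) : OCSet X := ⟨K, Or.inr K.isCompact.isClosed⟩

/-- The whole space, as a member of the family. -/
def whole (X : Type*) [TopologicalSpace X] : OCSet X := ⟨univ, Or.inl isOpen_univ⟩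

end OCSet

/-- The finite deficient topological measures on `X`: set functions on the open and the closed
sets with values in `[0, ∞]` that are additive on disjoint compact sets, inner compact regular on
open sets, outer regular on closed sets, and finite on the whole space. -/
structure DTM (X : Type*) [TopologicalSpace X] [T2Space X] where
  /-- The underlying set function. -/
  toFun : OCSet X → ℝ≥0∞
  add_compact : ∀ C K : Compacts X, Disjoint (C : Set X) (K : Set X) →
    toFun (OCSet.ofCompact (C ⊔ K)) = toFun (OCSet.ofCompact C) + toFun (OCSet.ofCompact K)
  inner_regular : ∀ U : Opens X,
    toFun (OCSet.ofOpen U) =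
      ⨆ (K : Compacts X) (_ : (K : Set X) ⊆ (U : Set X)), toFun (OCSet.ofCompact K)
  outer_regular : ∀ F : Closeds X,
    toFun (OCSet.ofClosed F) =
      ⨅ (U : Opens X) (_ : (F : Set X) ⊆ (U : Set X)), toFun (OCSet.ofOpen U)
  finite : toFun (OCSet.whole X) < ∞

namespace DTM

variable {X : Type*} [TopologicalSpace X] [T2Space X]

instance : CoeFun (DTM X) (fun _ => OCSet X → ℝ≥0∞) := ⟨DTM.toFun⟩

/-- The open superlevel set `{x | t < f x}`. -/
def superlevel (f : C₀(X, ℝ)) (t : ℝ) : OCSet X :=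
  ⟨{x | t < f x}, Or.inl (isOpen_lt continuous_const (map_continuous f))⟩

/-- The quasi-integral `∫ f dμ = ∫ t in 0..b, μ {x | t < f x}` of a nonnegative function `f`
that vanishes at infinity, where `[0, b]` contains the range of `f`; here `b = ‖f‖`. -/
def quasiIntegral (μ : DTM X) (f : C₀(X, ℝ)) : ℝ :=
  ∫ t in (0 : ℝ)..‖f‖, (μ (superlevel f t)).toReal

/-- The weak topology on the finite deficient topological measures: the coarsest topology that
makes `μ ↦ ∫ f dμ` continuous for every nonnegative `f` vanishing at infinity. -/
instance : TopologicalSpace (DTM X) :=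
  ⨅ f : {f : C₀(X, ℝ) // ∀ x, 0 ≤ f x},
    TopologicalSpace.induced (fun μ : DTM X => μ.quasiIntegral f.1) inferInstance

/-- A deficient topological measure is a topological measure if it is additive on disjoint sets
`A`, `B` as soon as each of `A`, `B`, `A ∪ B` is compact or open. (The two regularity conditions
are the same for topological measures and for deficient topological measures.) -/
def IsTopologicalMeasure (μ : DTM X) : Prop :=
  ∀ A B C : OCSet X, Disjoint (A : Set X) (B : Set X) → (C : Set X) = (A : Set X) ∪ (B : Set X) →
    (IsCompact (A : Set X) ∨ IsOpen (A : Set X)) →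
    (IsCompact (B : Set X) ∨ IsOpen (B : Set X)) →
    (IsCompact (C : Set X) ∨ IsOpen (C : Set X)) →
    μ C = μ A + μ B

/-- A deficient topological measure is proper if the only Radon measure below it is zero.
`Measure.Regular` is the Radon property: finite on compact sets, outer regular on Borel sets,
inner compact regular on open sets. -/
def IsProper [MeasurableSpace X] (μ : DTM X) : Prop :=
  ∀ m : Measure X, m.Regular → (∀ A : OCSet X, m (A : Set X) ≤ μ A) → m = 0

end DTM

section Families

variable (X : Type*) [TopologicalSpace X] [T2Space X]

/-- The finite topological measures. -/
def finiteTM : Set (DTM X) := {μ | μ.IsTopologicalMeasure}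

/-- The restrictions to the open and closed sets of the finite Borel measures that are outer
regular on Borel sets and inner compact regular on open sets. -/
def finiteM [MeasurableSpace X] : Set (DTM X) :=
  {μ | ∃ m : Measure X, IsFiniteMeasure m ∧ m.Regular ∧ ∀ A : OCSet X, μ A = m (A : Set X)}

/-- The proper finite deficient topological measures. -/
def properDTM [MeasurableSpace X] : Set (DTM X) := {μ | μ.IsProper}

/-- The proper finite topological measures. -/
def properTM [MeasurableSpace X] : Set (DTM X) := {μ | μ.IsTopologicalMeasure ∧ μ.IsProper}

end Families

/-- A subset of a compact space is solid if it and its complement are connected (the empty set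
counts as connected). -/
def IsSolidSet {Y : Type*} [TopologicalSpace Y] (A : Set Y) : Prop :=
  IsPreconnected A ∧ IsPreconnected Aᶜ

/-- A compact space has genus zero if every finite union of pairwise disjoint closed solid sets
has a connected complement (the empty set counts as connected). -/
def HasGenusZero (Y : Type*) [TopologicalSpace Y] : Prop :=
  ∀ S : Finset (Set Y), (∀ C ∈ S, IsClosed C ∧ IsSolidSet C) →
    (S : Set (Set Y)).PairwiseDisjoint id → IsPreconnected (⋃ C ∈ S, C)ᶜ

/-- The one-point compactification has genus zero, where a compact space is its own
compactification. (`OnePoint Y` would add an isolated point to a compact space `Y`.) -/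
def CompactificationHasGenusZero (Y : Type*) [TopologicalSpace Y] : Prop :=
  (CompactSpace Y → HasGenusZero Y) ∧ (¬ CompactSpace Y → HasGenusZero (OnePoint Y))

/-- Connected, locally connected, locally compact spaces with more than one point and without
cut points, whose one-point compactification has genus zero. -/
structure IsGenusZeroNoCutPoints (Y : Type*) [TopologicalSpace Y] : Prop where
  nontrivial : Nontrivial Y
  connected : ConnectedSpace Y
  locallyConnected : LocallyConnectedSpace Y
  locallyCompact : LocallyCompactSpace Y
  no_cut_point : ∀ y : Y, IsConnected ({y}ᶜ : Set Y)
  genus_zero : CompactificationHasGenusZero Y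

end

set_option linter.unusedSectionVars false

namespace OCSet

variable {X : Type*} [TopologicalSpace X]

/-! Density is tested in the product space of functions on the nonnegative test functions: the weak
topology is induced from it by `pairing`, and `pairing` respects sums and nonnegative multiples. The
closure of a family stable under sums therefore becomes a closed additive monoid.

Proper families are stable under sums (`IsProper.add`). The largest Radon measure below `μ`,
`maxMeasure`, is generated by countable Borel covers weighted with the inner content of `μ`. If `μ`
is proper, this measure vanishes, so the space splits into countably many Borel pieces of
arbitrarily small total inner content. Two such partitions have a common refinement, along which a
Radon measure below the sum is forced to vanish.

For (1) and (2), a Radon measure is cut along the disjointed cover. Each piece lives on one `Xi i`,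
is approximated there and pushed forward; the countable sum of the pieces converges on every test
function (`finiteM_subset_closure_of_iUnion`).

For (3), subtracting `maxMeasure` splits a set function into a Radon part and a proper part
(`exists_measure_add_proper`), so only Radon measures need approximation. These are integrals of
point masses, and the proper topological measures form a convex cone, so approximating point masses
is enough (`finiteM_subset_closure_of_evaluation`). Near a point, choose three points in a small
connected open set. A set receives mass one if each of its open neighbourhoods contains a closed
connected set `K` such that no connected set missing `K` contains two of the three points; otherwise
it receives mass zero. Disjoint sets cannot both have mass one (`not_disjoint_of_blocks`). Genus
zero and the absence of cut points give mass one to a closed set or to its complement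
(`isBig_compl_of_not_isBig`), hence additivity. The absence of cut points also makes singletons null
(`not_isBig_singleton`), hence properness. -/

theorem eq_ofOpen (A : OCSet X) (h : IsOpen (A : Set X)) : A = ofOpen ⟨A, h⟩ := rfl

end OCSet

/-! ### Set functions determined by their values on open and compact sets -/

namespace DTM

section Basic

variable {X : Type*} [TopologicalSpace X] [T2Space X] (μ : DTM X)

theorem ofOpen_mono {U V : Opens X} (h : (U : Set X) ⊆ V) :
    μ (OCSet.ofOpen U) ≤ μ (OCSet.ofOpen V) := by
  rw [μ.inner_regular U, μ.inner_regular V]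
  exact iSup₂_le fun K hK => le_iSup₂_of_le K (hK.trans h) le_rfl

/-- Monotonicity on open sets makes outer regularity valid for open sets too, so comparisons between
arbitrary members of the domain reduce to open ones. -/
theorem apply_eq_iInf (A : OCSet X) :
    μ A = ⨅ (U : Opens X) (_ : (A : Set X) ⊆ (U : Set X)), μ (OCSet.ofOpen U) := by
  rcases A.2 with h | h
  · rw [OCSet.eq_ofOpen A h]
    exact le_antisymm (le_iInf₂ fun U hU => μ.ofOpen_mono hU)
      (iInf₂_le (⟨A, h⟩ : Opens X) (Subset.refl _))
  · exact μ.outer_regular ⟨A, h⟩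

theorem mono {A B : OCSet X} (h : (A : Set X) ⊆ B) : μ A ≤ μ B := by
  rw [μ.apply_eq_iInf A, μ.apply_eq_iInf B]
  exact le_iInf₂ fun U hU => iInf₂_le U (h.trans hU)

theorem lt_top (A : OCSet X) : μ A < ∞ := (μ.mono (subset_univ _)).trans_lt μ.finite

theorem apply_eq_zero_of_eq_empty {A : OCSet X} (h : (A : Set X) = ∅) : μ A = 0 := by
  have hA : A = OCSet.ofCompact ⊥ := Subtype.ext h
  have := μ.add_compact ⊥ ⊥ (by simp)
  rw [sup_idem, ← hA] at this
  simpa using (ENNReal.add_right_inj (μ.lt_top A).ne).1 (this.symm.trans (add_zero _).symm)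

theorem exists_compact_lt {U : Opens X} {r : ℝ≥0∞} (h : r < μ (OCSet.ofOpen U)) :
    ∃ K : Compacts X, (K : Set X) ⊆ U ∧ r < μ (OCSet.ofCompact K) := by
  rw [μ.inner_regular U] at h
  simpa [lt_iSup_iff] using h

/-- A finite deficient topological measure from its values on the open and on the compact sets;
the value at a closed set is defined by outer regularity. -/
noncomputable def ofOpensCompacts (o : Opens X → ℝ≥0∞) (κ : Compacts X → ℝ≥0∞)
    (hadd : ∀ C K : Compacts X, Disjoint (C : Set X) (K : Set X) → κ (C ⊔ K) = κ C + κ K)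
    (hmono : ∀ (K : Compacts X) (U : Opens X), (K : Set X) ⊆ U → κ K ≤ o U)
    (hin : ∀ U : Opens X, o U ≤ ⨆ (K : Compacts X) (_ : (K : Set X) ⊆ (U : Set X)), κ K)
    (hout : ∀ K : Compacts X, ⨅ (U : Opens X) (_ : (K : Set X) ⊆ (U : Set X)), o U ≤ κ K)
    (hfin : o ⊤ < ∞) : DTM X :=
  have ho : ∀ U : Opens X, ⨅ (V : Opens X) (_ : (U : Set X) ⊆ (V : Set X)), o V = o U :=
    fun U => le_antisymm (iInf₂_le U (Subset.refl _)) <| le_iInf₂ fun V hV =>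
      (hin U).trans (iSup₂_le fun K hK => hmono K V (hK.trans hV))
  have hκ : ∀ K : Compacts X, ⨅ (V : Opens X) (_ : (K : Set X) ⊆ (V : Set X)), o V = κ K :=
    fun K => le_antisymm (hout K) (le_iInf₂ fun V hV => hmono K V hV)
  { toFun := fun A => ⨅ (U : Opens X) (_ : (A : Set X) ⊆ (U : Set X)), o U
    add_compact := fun C K h => by
      simpa only [OCSet.ofCompact, hκ] using hadd C K h
    inner_regular := fun U => by
      simp only [OCSet.ofCompact, OCSet.ofOpen, hκ, ho]
      exact le_antisymm (hin U) (iSup₂_le fun K hK => hmono K U hK)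
    outer_regular := fun F => by
      simp only [OCSet.ofClosed, OCSet.ofOpen, ho]
    finite := (iInf₂_le ⊤ (by simp)).trans_lt hfin }

section

variable {o : Opens X → ℝ≥0∞} {κ : Compacts X → ℝ≥0∞}
  {hadd : ∀ C K : Compacts X, Disjoint (C : Set X) (K : Set X) → κ (C ⊔ K) = κ C + κ K}
  {hmono : ∀ (K : Compacts X) (U : Opens X), (K : Set X) ⊆ U → κ K ≤ o U}
  {hin : ∀ U : Opens X, o U ≤ ⨆ (K : Compacts X) (_ : (K : Set X) ⊆ (U : Set X)), κ K}
  {hout : ∀ K : Compacts X, ⨅ (U : Opens X) (_ : (K : Set X) ⊆ (U : Set X)), o U ≤ κ K}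
  {hfin : o ⊤ < ∞}

@[simp]
theorem ofOpensCompacts_ofOpen (U : Opens X) :
    ofOpensCompacts o κ hadd hmono hin hout hfin (OCSet.ofOpen U) = o U :=
  le_antisymm (iInf₂_le U (Subset.refl _)) <| le_iInf₂ fun V hV =>
    (hin U).trans (iSup₂_le fun K hK => hmono K V (hK.trans hV))

@[simp]
theorem ofOpensCompacts_ofCompact (K : Compacts X) :
    ofOpensCompacts o κ hadd hmono hin hout hfin (OCSet.ofCompact K) = κ K :=
  le_antisymm (hout K) (le_iInf₂ fun V hV => hmono K V hV)

end

end Basic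

/-! ### Sums, multiples and restrictions of measures -/

section Operations

variable {X : Type*} [TopologicalSpace X] [T2Space X]

/-- The zero set function. -/
noncomputable instance : Zero (DTM X) :=
  ⟨ofOpensCompacts 0 0 (by simp) (by simp) (by simp)
    (fun K => iInf₂_le_of_le ⊤ (by simp) le_rfl) (by simp)⟩

/-- The sum of two deficient topological measures on the open and the compact sets. -/
noncomputable instance : Add (DTM X) where
  add μ ν := ofOpensCompacts (fun U => μ (OCSet.ofOpen U) + ν (OCSet.ofOpen U))
    (fun K => μ (OCSet.ofCompact K) + ν (OCSet.ofCompact K))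
    (fun C K h => by rw [μ.add_compact C K h, ν.add_compact C K h, add_add_add_comm])
    (fun K U h => add_le_add (μ.mono h) (ν.mono h))
    (fun U => by
      rw [μ.inner_regular U, ν.inner_regular U]
      refine ENNReal.biSup_add_biSup_le' ⟨⊥, by simp⟩ ⟨⊥, by simp⟩ fun K hK L hL => ?_
      refine le_iSup₂_of_le (K ⊔ L) (by simp [hK, hL]) ?_
      exact add_le_add (μ.mono (by simp [OCSet.ofCompact])) (ν.mono (by simp [OCSet.ofCompact])))
    (fun K => by
      rw [μ.apply_eq_iInf (OCSet.ofCompact K), ν.apply_eq_iInf (OCSet.ofCompact K)]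
      refine ENNReal.le_iInf₂_add_iInf₂ fun U hU V hV => ?_
      refine iInf₂_le_of_le (U ⊓ V) (subset_inter hU hV) ?_
      exact add_le_add (μ.mono inter_subset_left) (ν.mono inter_subset_right))
    (ENNReal.add_lt_top.2 ⟨μ.lt_top _, ν.lt_top _⟩)

/-- A nonnegative multiple of a deficient topological measure. -/
noncomputable instance : SMul NNReal (DTM X) where
  smul c μ := ofOpensCompacts (fun U => c * μ (OCSet.ofOpen U))
    (fun K => c * μ (OCSet.ofCompact K))
    (fun C K h => by rw [μ.add_compact C K h, mul_add])
    (fun K U h => by gcongr; exact μ.mono h)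
    (fun U => by simp only [μ.inner_regular U, ENNReal.mul_iSup, le_refl])
    (fun K => by
      rcases eq_or_ne c 0 with rfl | hc
      · exact iInf₂_le_of_le ⊤ (by simp) (by simp)
      · rw [μ.apply_eq_iInf (OCSet.ofCompact K)]
        have h0 : (c : ℝ≥0∞) ≠ 0 := by simpa using hc
        simp only [ENNReal.mul_iInf_of_ne h0 ENNReal.coe_ne_top]
        exact le_rfl)
    (ENNReal.mul_lt_top ENNReal.coe_lt_top (μ.lt_top _))

@[simp]
theorem zero_ofOpen (U : Opens X) : (0 : DTM X) (OCSet.ofOpen U) = 0 :=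
  ofOpensCompacts_ofOpen U

@[simp]
theorem zero_ofCompact (K : Compacts X) : (0 : DTM X) (OCSet.ofCompact K) = 0 :=
  ofOpensCompacts_ofCompact K

@[simp]
theorem add_ofOpen (μ ν : DTM X) (U : Opens X) :
    (μ + ν) (OCSet.ofOpen U) = μ (OCSet.ofOpen U) + ν (OCSet.ofOpen U) :=
  ofOpensCompacts_ofOpen U

@[simp]
theorem add_ofCompact (μ ν : DTM X) (K : Compacts X) :
    (μ + ν) (OCSet.ofCompact K) = μ (OCSet.ofCompact K) + ν (OCSet.ofCompact K) :=
  ofOpensCompacts_ofCompact K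

@[simp]
theorem smul_ofOpen (c : NNReal) (μ : DTM X) (U : Opens X) :
    (c • μ) (OCSet.ofOpen U) = c * μ (OCSet.ofOpen U) :=
  ofOpensCompacts_ofOpen U

@[simp]
theorem smul_ofCompact (c : NNReal) (μ : DTM X) (K : Compacts X) :
    (c • μ) (OCSet.ofCompact K) = c * μ (OCSet.ofCompact K) :=
  ofOpensCompacts_ofCompact K

/-- An identity between values on open and on compact sets, as needed for additivity. -/
theorem apply_of_compact_or_open {p : OCSet X → Prop} {A : OCSet X}
    (hA : IsCompact (A : Set X) ∨ IsOpen (A : Set X)) (ho : ∀ U : Opens X, p (OCSet.ofOpen U))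
    (hc : ∀ K : Compacts X, p (OCSet.ofCompact K)) : p A :=
  hA.elim (fun h => hc ⟨A, h⟩) (fun h => ho ⟨A, h⟩)

theorem IsTopologicalMeasure.zero : (0 : DTM X).IsTopologicalMeasure := by
  intro A B C _ _ hA hB hC
  have key : ∀ A : OCSet X, (IsCompact (A : Set X) ∨ IsOpen (A : Set X)) → (0 : DTM X) A = 0 :=
    fun A hA => apply_of_compact_or_open (p := fun A => (0 : DTM X) A = 0) hA zero_ofOpen zero_ofCompact
  simp [key A hA, key B hB, key C hC]

theorem IsTopologicalMeasure.add {μ ν : DTM X} (hμ : μ.IsTopologicalMeasure)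
    (hν : ν.IsTopologicalMeasure) : (μ + ν).IsTopologicalMeasure := by
  intro A B C hd hU hA hB hC
  have key : ∀ A : OCSet X, (IsCompact (A : Set X) ∨ IsOpen (A : Set X)) →
      (μ + ν) A = μ A + ν A :=
    fun A hA => apply_of_compact_or_open (p := fun A => (μ + ν) A = μ A + ν A) hA
      (add_ofOpen μ ν) (add_ofCompact μ ν)
  rw [key A hA, key B hB, key C hC, hμ A B C hd hU hA hB hC, hν A B C hd hU hA hB hC,
    add_add_add_comm]

theorem IsTopologicalMeasure.smul {μ : DTM X} (hμ : μ.IsTopologicalMeasure) (c : NNReal) :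
    (c • μ).IsTopologicalMeasure := by
  intro A B C hd hU hA hB hC
  have key : ∀ A : OCSet X, (IsCompact (A : Set X) ∨ IsOpen (A : Set X)) →
      (c • μ) A = c * μ A :=
    fun A hA => apply_of_compact_or_open (p := fun A => (c • μ) A = c * μ A) hA
      (smul_ofOpen c μ) (smul_ofCompact c μ)
  rw [key A hA, key B hB, key C hC, hμ A B C hd hU hA hB hC, mul_add]

/-- The restriction of a finite Radon measure to the open and the closed sets. -/
noncomputable def ofMeasure [MeasurableSpace X] [BorelSpace X] (m : Measure X) [IsFiniteMeasure m]
    [m.Regular] : DTM X where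
  toFun A := m A
  add_compact C K h := measure_union h K.isCompact.measurableSet
  inner_regular U := by
    simp only [OCSet.ofOpen, OCSet.ofCompact, U.isOpen.measure_eq_iSup_isCompact]
    refine le_antisymm (iSup₂_le fun K hK => iSup_le fun hc => ?_)
      (iSup₂_le fun K hK => le_iSup₂_of_le (K : Set X) hK (le_iSup_of_le K.isCompact le_rfl))
    exact le_iSup₂_of_le (⟨K, hc⟩ : Compacts X) hK le_rfl
  outer_regular F := by
    simp only [OCSet.ofOpen, OCSet.ofClosed, (F : Set X).measure_eq_iInf_isOpen]
    refine le_antisymm (le_iInf₂ fun U hU => iInf₂_le_of_le (U : Set X) hU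
      (iInf_le_of_le U.isOpen le_rfl)) (le_iInf₂ fun U hU => le_iInf fun ho => ?_)
    exact iInf₂_le_of_le (⟨U, ho⟩ : Opens X) hU le_rfl
  finite := measure_lt_top m _

end Operations

/-! ### Quasi-integrals -/

section QuasiIntegral

variable {X Y : Type*} [TopologicalSpace X] [T2Space X] [TopologicalSpace Y] [T2Space Y]

theorem superlevel_eq_ofOpen {X : Type*} [TopologicalSpace X] (f : C₀(X, ℝ)) (t : ℝ) :
    superlevel f t = OCSet.ofOpen ⟨{x | t < f x}, isOpen_lt continuous_const (map_continuous f)⟩ := rfl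

theorem antitone_toReal_superlevel (μ : DTM X) (f : C₀(X, ℝ)) :
    Antitone fun t => (μ (superlevel f t)).toReal := fun _ _ h =>
  ENNReal.toReal_mono (μ.lt_top _).ne (μ.mono fun _ hx => lt_of_le_of_lt h hx)

theorem superlevel_eq_zero (μ : DTM X) {f : C₀(X, ℝ)} {t : ℝ} (h : ‖f‖ ≤ t) :
    μ (superlevel f t) = 0 := by
  refine μ.apply_eq_zero_of_eq_empty (eq_empty_of_forall_notMem fun x hx => ?_)
  exact absurd ((le_abs_self _).trans ((f.toBCF.norm_coe_le_norm x).trans h)) (not_le.2 hx)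

theorem integrableOn_superlevel (μ : DTM X) (f : C₀(X, ℝ)) :
    IntegrableOn (fun t => (μ (superlevel f t)).toReal) (Ioi 0) := by
  rw [← Ioc_union_Ioi_eq_Ioi (norm_nonneg f)]
  refine IntegrableOn.union ?_ ?_
  · exact (intervalIntegrable_iff_integrableOn_Ioc_of_le (norm_nonneg f)).1
      (μ.antitone_toReal_superlevel f).intervalIntegrable
  · refine (integrableOn_zero).congr_fun (fun t ht => ?_) measurableSet_Ioi
    simp [μ.superlevel_eq_zero (le_of_lt ht)]

/-- Superlevel sets above the norm are empty. Removing the norm from the domain of integration lets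
functions of different norms, even on different spaces, be compared levelwise. -/
theorem quasiIntegral_eq_integral_Ioi (μ : DTM X) (f : C₀(X, ℝ)) :
    μ.quasiIntegral f = ∫ t in Ioi (0 : ℝ), (μ (superlevel f t)).toReal := by
  rw [quasiIntegral, intervalIntegral.integral_of_le (norm_nonneg f)]
  refine (setIntegral_eq_of_subset_of_forall_sdiff_eq_zero measurableSet_Ioi
    Ioc_subset_Ioi_self fun t ht => ?_).symm
  have : ‖f‖ ≤ t := by
    by_contra h
    exact ht.2 ⟨ht.1, (not_le.1 h).le⟩
  simp [μ.superlevel_eq_zero this]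

theorem quasiIntegral_congr {μ : DTM X} {ν : DTM Y} {f : C₀(X, ℝ)} {g : C₀(Y, ℝ)}
    (h : ∀ t, 0 < t → μ (superlevel f t) = ν (superlevel g t)) :
    μ.quasiIntegral f = ν.quasiIntegral g := by
  rw [quasiIntegral_eq_integral_Ioi, quasiIntegral_eq_integral_Ioi]
  exact setIntegral_congr_fun measurableSet_Ioi fun t ht => by simp only [h t ht]

theorem quasiIntegral_of_ofOpen_eq_add {μ μ₁ μ₂ : DTM X}
    (h : ∀ U : Opens X, μ (OCSet.ofOpen U) = μ₁ (OCSet.ofOpen U) + μ₂ (OCSet.ofOpen U))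
    (f : C₀(X, ℝ)) : μ.quasiIntegral f = μ₁.quasiIntegral f + μ₂.quasiIntegral f := by
  simp only [quasiIntegral_eq_integral_Ioi]
  rw [← integral_add (μ₁.integrableOn_superlevel f) (μ₂.integrableOn_superlevel f)]
  refine setIntegral_congr_fun measurableSet_Ioi fun t _ => ?_
  rw [← ENNReal.toReal_add (μ₁.lt_top _).ne (μ₂.lt_top _).ne, superlevel_eq_ofOpen, h]

theorem quasiIntegral_zero (f : C₀(X, ℝ)) : (0 : DTM X).quasiIntegral f = 0 := by
  have := quasiIntegral_of_ofOpen_eq_add (μ := (0 : DTM X)) (μ₁ := 0) (μ₂ := 0) (by simp) f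
  linarith

theorem quasiIntegral_smul (c : NNReal) (μ : DTM X) (f : C₀(X, ℝ)) :
    (c • μ).quasiIntegral f = c * μ.quasiIntegral f := by
  simp only [quasiIntegral_eq_integral_Ioi]
  rw [← integral_const_mul]
  refine setIntegral_congr_fun measurableSet_Ioi fun t _ => ?_
  rw [superlevel_eq_ofOpen, smul_ofOpen, ENNReal.toReal_mul, ENNReal.coe_toReal]

theorem _root_.ZeroAtInftyContinuousMap.integrable_of_isFiniteMeasure {X : Type*}
    [TopologicalSpace X] [MeasurableSpace X] [BorelSpace X] (f : C₀(X, ℝ)) (m : Measure X) [IsFiniteMeasure m] :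
    Integrable (fun x => f x) m :=
  Integrable.of_bound (map_continuous f).measurable.aestronglyMeasurable ‖f‖
    (Filter.Eventually.of_forall fun x => f.toBCF.norm_coe_le_norm x)

theorem quasiIntegral_eq_integral [MeasurableSpace X] [BorelSpace X] {μ : DTM X} {m : Measure X}
    [IsFiniteMeasure m] (h : ∀ U : Opens X, μ (OCSet.ofOpen U) = m U) {f : C₀(X, ℝ)}
    (hf : ∀ x, 0 ≤ f x) : μ.quasiIntegral f = ∫ x, f x ∂m := by
  rw [quasiIntegral_eq_integral_Ioi, (f.integrable_of_isFiniteMeasure m).integral_eq_integral_meas_lt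
    (Filter.Eventually.of_forall hf)]
  exact setIntegral_congr_fun measurableSet_Ioi fun t _ => by
    rw [superlevel_eq_ofOpen, h]
    rfl

/-- A set function of total mass one that is concentrated on a compact set on which `f` is close
to a constant has a quasi-integral close to that constant. -/
theorem abs_quasiIntegral_sub_le {μ : DTM X} (hμ : μ (OCSet.whole X) = 1) {K : Compacts X}
    (hK : μ (OCSet.ofCompact K) = 1) {f : C₀(X, ℝ)} {c ε : ℝ} (hc : 0 ≤ c)
    (hf : ∀ x ∈ K, |f x - c| < ε) : |μ.quasiIntegral f - c| ≤ ε := by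
  have hKne : (K : Set X).Nonempty := by
    by_contra h
    have := μ.apply_eq_zero_of_eq_empty (A := OCSet.ofCompact K) (not_nonempty_iff_eq_empty.1 h)
    simp [this] at hK
  obtain ⟨x₀, hx₀⟩ := hKne
  have hε : 0 < ε := (abs_nonneg _).trans_lt (hf x₀ hx₀)
  have hint := μ.integrableOn_superlevel f
  have hle : ∀ t, (μ (superlevel f t)).toReal ≤ 1 := fun t =>
    ENNReal.toReal_le_of_le_ofReal zero_le_one (by
      simpa [hμ] using μ.mono (A := superlevel f t) (B := OCSet.whole X) (subset_univ _))
  have hone : ∀ t, t ≤ c - ε → (μ (superlevel f t)).toReal = 1 := fun t ht => by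
    refine le_antisymm (hle t) ?_
    have : μ (OCSet.ofCompact K) ≤ μ (superlevel f t) := μ.mono fun x hx => by
      have := (abs_lt.1 (hf x hx)).1
      change t < f x
      linarith
    rw [hK] at this
    simpa using ENNReal.toReal_mono (μ.lt_top _).ne this
  have hzero : ∀ t, c + ε ≤ t → (μ (superlevel f t)).toReal = 0 := fun t ht => by
    -- A superlevel set of positive mass at this height would contain a compact set of positive mass
    -- disjoint from `K`, pushing the total mass above one.
    by_contra h
    have h0 : 0 < μ (superlevel f t) := (ENNReal.toReal_pos_iff.1
      (lt_of_le_of_ne ENNReal.toReal_nonneg (Ne.symm h))).1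
    obtain ⟨L, hL, hL0⟩ := μ.exists_compact_lt
      (U := ⟨_, (isOpen_lt continuous_const (map_continuous f) : IsOpen {x | t < f x})⟩) h0
    have hd : Disjoint (K : Set X) (L : Set X) := by
      refine disjoint_left.2 fun x hx hx' => ?_
      have := (abs_lt.1 (hf x hx)).2
      have h2 : t < f x := hL hx'
      linarith
    have h1 := μ.add_compact K L hd
    have h2 : μ (OCSet.ofCompact (K ⊔ L)) ≤ 1 := hμ ▸ μ.mono (subset_univ _)
    rw [h1, hK] at h2
    exact absurd h2 (not_le.2 (ENNReal.lt_add_right ENNReal.one_ne_top hL0.ne'))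
  rw [quasiIntegral_eq_integral_Ioi, abs_le]
  constructor
  · rcases le_total (c - ε) 0 with h | h
    · have : 0 ≤ ∫ t in Ioi (0 : ℝ), (μ (superlevel f t)).toReal :=
        integral_nonneg fun t => ENNReal.toReal_nonneg
      linarith
    · have h1 : ∫ t in Ioc 0 (c - ε), (1 : ℝ) ≤ ∫ t in Ioi (0 : ℝ), (μ (superlevel f t)).toReal :=
        calc ∫ t in Ioc 0 (c - ε), (1 : ℝ)
            = ∫ t in Ioc 0 (c - ε), (μ (superlevel f t)).toReal :=
              setIntegral_congr_fun measurableSet_Ioc fun t ht => (hone t ht.2).symm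
          _ ≤ _ := setIntegral_mono_set hint
              (Filter.Eventually.of_forall fun t => ENNReal.toReal_nonneg)
              Ioc_subset_Ioi_self.eventuallyLE
      simp [h] at h1
      linarith
  · have h1 : ∫ t in Ioi (0 : ℝ), (μ (superlevel f t)).toReal ≤ ∫ t in Ioc 0 (c + ε), (1 : ℝ) :=
      calc ∫ t in Ioi (0 : ℝ), (μ (superlevel f t)).toReal
          = ∫ t in Ioc 0 (c + ε), (μ (superlevel f t)).toReal :=
            setIntegral_eq_of_subset_of_forall_sdiff_eq_zero measurableSet_Ioi
              Ioc_subset_Ioi_self fun t ht => hzero t (by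
                by_contra h
                exact ht.2 ⟨ht.1, (not_le.1 h).le⟩)
        _ ≤ _ := setIntegral_mono_on (hint.mono_set Ioc_subset_Ioi_self)
            (by simp) measurableSet_Ioc fun t _ => hle t
    have h2 : 0 ≤ c + ε := by linarith
    simp [h2] at h1
    linarith

end QuasiIntegral

/-! ### The weak topology as pointwise convergence on test functions -/

section WeakTopology

variable (X : Type*) [TopologicalSpace X] [T2Space X]

/-- The index set of the weak topology: nonnegative functions vanishing at infinity. -/
abbrev TestFunction : Type _ := {f : C₀(X, ℝ) // ∀ x, 0 ≤ f x}

variable {X}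

/-- The quasi-integrals of all nonnegative functions that vanish at infinity. -/
noncomputable def pairing (μ : DTM X) : TestFunction X → ℝ := fun f => μ.quasiIntegral f.1

theorem topology_eq_induced_pairing :
    (inferInstance : TopologicalSpace (DTM X)) = induced pairing Pi.topologicalSpace := by
  rw [Pi.topologicalSpace, induced_iInf]
  simp only [induced_compose]
  rfl

theorem mem_closure_iff_pairing {S : Set (DTM X)} {μ : DTM X} :
    μ ∈ closure S ↔ pairing μ ∈ closure (pairing '' S) := by
  have : ∀ t : TopologicalSpace (DTM X), t = induced pairing Pi.topologicalSpace →
      (μ ∈ @closure _ t S ↔ pairing μ ∈ closure (pairing '' S)) := by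
    rintro _ rfl
    exact closure_induced
  exact this _ topology_eq_induced_pairing

theorem pairing_zero : pairing (0 : DTM X) = 0 := funext fun f => quasiIntegral_zero f.1

theorem pairing_add (μ ν : DTM X) : pairing (μ + ν) = pairing μ + pairing ν :=
  funext fun f => quasiIntegral_of_ofOpen_eq_add (add_ofOpen μ ν) f.1

theorem pairing_smul (c : NNReal) (μ : DTM X) : pairing (c • μ) = (c : ℝ) • pairing μ :=
  funext fun f => quasiIntegral_smul c μ f.1

end WeakTopology

end DTM

/-! ### The inner content and the largest Radon measure below a set function -/

namespace DTM

section InnerContent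

variable {X : Type*} [TopologicalSpace X] [T2Space X] (μ ν : DTM X)

/-- The inner extension of a deficient topological measure to all subsets. -/
noncomputable def inner (B : Set X) : ℝ≥0∞ :=
  ⨆ (K : Compacts X) (_ : (K : Set X) ⊆ B), μ (OCSet.ofCompact K)

theorem le_inner {K : Compacts X} {B : Set X} (h : (K : Set X) ⊆ B) :
    μ (OCSet.ofCompact K) ≤ μ.inner B :=
  le_iSup₂_of_le K h le_rfl

theorem inner_mono {B C : Set X} (h : B ⊆ C) : μ.inner B ≤ μ.inner C :=
  iSup₂_le fun _ hK => μ.le_inner (hK.trans h)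

theorem inner_le (A : OCSet X) : μ.inner (A : Set X) ≤ μ A :=
  iSup₂_le fun _ hK => μ.mono hK

theorem inner_lt_top (B : Set X) : μ.inner B < ∞ :=
  ((μ.inner_mono (subset_univ B)).trans (μ.inner_le (OCSet.whole X))).trans_lt μ.finite

theorem inner_empty : μ.inner ∅ = 0 := by
  refine le_antisymm ((μ.inner_le (OCSet.ofOpen ⊥)).trans ?_) zero_le
  rw [μ.apply_eq_zero_of_eq_empty (by simp [OCSet.ofOpen])]

theorem inner_add_inner_le {B C : Set X} (h : Disjoint B C) :
    μ.inner B + μ.inner C ≤ μ.inner (B ∪ C) := by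
  refine ENNReal.biSup_add_biSup_le' ⟨⊥, by simp⟩ ⟨⊥, by simp⟩ fun K hK L hL => ?_
  rw [← μ.add_compact K L (h.mono hK hL)]
  exact μ.le_inner (by rw [Compacts.coe_sup]; exact union_subset_union hK hL)

theorem sum_inner_le {ι : Type*} {B : ι → Set X} (h : Pairwise (Function.onFun Disjoint B))
    (s : Finset ι) : ∑ i ∈ s, μ.inner (B i) ≤ μ.inner (⋃ i ∈ s, B i) := by
  classical
  induction s using Finset.induction_on with
  | empty => simp [inner_empty]
  | insert a s ha ih =>
    rw [Finset.sum_insert ha, Finset.set_biUnion_insert]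
    refine (add_le_add le_rfl ih).trans (μ.inner_add_inner_le ?_)
    refine disjoint_iUnion₂_right.2 fun i hi => h ?_
    rintro rfl
    exact ha hi

theorem tsum_inner_le {ι : Type*} {B : ι → Set X} (h : Pairwise (Function.onFun Disjoint B)) :
    ∑' i, μ.inner (B i) ≤ μ.inner (⋃ i, B i) :=
  ENNReal.summable.tsum_le_of_sum_le fun s =>
    (μ.sum_inner_le h s).trans (μ.inner_mono (iUnion₂_subset_iUnion _ _))

theorem inner_add_le (B : Set X) : (μ + ν).inner B ≤ μ.inner B + ν.inner B :=
  iSup₂_le fun K hK => by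
    rw [add_ofCompact]
    exact add_le_add (μ.le_inner hK) (ν.le_inner hK)

end InnerContent

section MaxMeasure

variable {X : Type*} [TopologicalSpace X] [T2Space X] [MeasurableSpace X] [BorelSpace X]
  (μ ν : DTM X)

/-- Superadditivity of the inner content is exactly the Carathéodory inequality for the generating
weights. Nonmeasurable sets have weight `∞`, as an infimum over an empty family, so they impose no
condition. -/
theorem measurableSet_caratheodory {X : Type*} [TopologicalSpace X] [T2Space X]
    [MeasurableSpace X] (μ : DTM X) (B : Set X) (hB : MeasurableSet B) :
    MeasurableSet[(OuterMeasure.ofFunction (fun s => ⨅ _ : MeasurableSet s, μ.inner s)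
      (by simp [inner_empty])).caratheodory] B := by
  refine OuterMeasure.ofFunction_caratheodory fun t => ?_
  refine le_iInf fun ht => ?_
  simp only [ht.inter hB, ht.diff hB, iInf_pos]
  refine (μ.inner_add_inner_le (disjoint_sdiff_inter.symm)).trans (μ.inner_mono ?_)
  simp

/-- The largest Radon measure below a deficient topological measure. -/
noncomputable def maxMeasure : Measure X :=
  (OuterMeasure.ofFunction (fun s => ⨅ _ : MeasurableSet s, μ.inner s)
    (by simp [inner_empty])).toMeasure μ.measurableSet_caratheodory

theorem maxMeasure_le_inner {B : Set X} (hB : MeasurableSet B) : μ.maxMeasure B ≤ μ.inner B := by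
  rw [maxMeasure, toMeasure_apply _ _ hB]
  refine (OuterMeasure.ofFunction_le B).trans ?_
  simp [hB]

theorem le_maxMeasure {m : Measure X} (h : ∀ B, MeasurableSet B → m B ≤ μ.inner B) :
    m ≤ μ.maxMeasure := by
  refine Measure.le_iff.2 fun B hB => ?_
  rw [maxMeasure, toMeasure_apply _ _ hB]
  exact OuterMeasure.le_ofFunction (μ := m.toOuterMeasure).2 (fun s => le_iInf fun hs => h s hs) B

instance : IsFiniteMeasure μ.maxMeasure :=
  ⟨(μ.maxMeasure_le_inner MeasurableSet.univ).trans_lt (μ.inner_lt_top _)⟩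

/-- A compact `K ⊆ B` that nearly attains the inner content of `B` leaves little inner content on `B
\ K`, by superadditivity. The measure is bounded by the inner content, so it is small on `B \ K` as
well. -/
instance : μ.maxMeasure.InnerRegular where
  innerRegular := by
    intro B hB r hr
    have hε : μ.maxMeasure B - r ≠ 0 := (tsub_pos_of_lt hr).ne'
    have hpos : μ.inner B ≠ 0 := ((zero_le : 0 ≤ r).trans_lt
      (hr.trans_le (μ.maxMeasure_le_inner hB))).ne'
    obtain ⟨K, hK⟩ := lt_iSup_iff.1 (show μ.inner B - (μ.maxMeasure B - r) < ⨆ (K : Compacts X),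
      ⨆ (_ : (K : Set X) ⊆ B), μ (OCSet.ofCompact K) from
        ENNReal.sub_lt_self (μ.inner_lt_top B).ne hpos hε)
    obtain ⟨hKB, hK⟩ := lt_iSup_iff.1 hK
    refine ⟨K, hKB, K.isCompact, ?_⟩
    have h1 : μ.inner B < μ (OCSet.ofCompact K) + (μ.maxMeasure B - r) :=
      ENNReal.lt_add_of_sub_lt_right (Or.inl (μ.inner_lt_top B).ne) hK
    have h2 : μ.inner (K : Set X) + μ.inner (B \ K) ≤ μ.inner B := by
      refine (μ.inner_add_inner_le disjoint_sdiff_right).trans (μ.inner_mono ?_)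
      simp [hKB]
    have h3 : μ (OCSet.ofCompact K) + μ.inner (B \ K) <
        μ (OCSet.ofCompact K) + (μ.maxMeasure B - r) :=
      ((add_le_add (μ.le_inner subset_rfl) le_rfl).trans h2).trans_lt h1
    have h4 : μ.maxMeasure (B \ K) < μ.maxMeasure B - r :=
      (μ.maxMeasure_le_inner (hB.diff K.isCompact.measurableSet)).trans_lt
        (lt_of_add_lt_add_left h3)
    by_contra hle
    have h5 : μ.maxMeasure B ≤ μ.maxMeasure (K : Set X) + μ.maxMeasure (B \ K) := by
      refine le_trans (measure_mono ?_) (measure_union_le _ _)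
      simp
    have h6 : μ.maxMeasure B < r + (μ.maxMeasure B - r) :=
      h5.trans_lt (ENNReal.add_lt_add_of_le_of_lt (measure_ne_top _ _) (not_lt.1 hle) h4)
    rw [add_tsub_cancel_of_le hr.le] at h6
    exact lt_irrefl _ h6

instance : μ.maxMeasure.Regular := inferInstance

theorem isFiniteMeasure_of_le {X : Type*} [TopologicalSpace X] [T2Space X]
    [MeasurableSpace X] (μ : DTM X) {m : Measure X}
    (h : ∀ U : Opens X, m U ≤ μ (OCSet.ofOpen U)) : IsFiniteMeasure m :=
  ⟨(h ⊤).trans_lt (μ.lt_top _)⟩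

/-- Outer regularity of the set function carries the bound from open to compact sets; inner
regularity of the finite measure `m` then carries it to all Borel sets. -/
theorem measure_le_inner {m : Measure X} [m.Regular]
    (h : ∀ U : Opens X, m U ≤ μ (OCSet.ofOpen U)) {B : Set X} (hB : MeasurableSet B) :
    m B ≤ μ.inner B := by
  have := μ.isFiniteMeasure_of_le h
  rw [hB.measure_eq_iSup_isCompact_of_ne_top (measure_ne_top m B)]
  refine iSup₂_le fun K hKB => iSup_le fun hK => ?_
  refine le_trans ?_ (μ.le_inner (K := ⟨K, hK⟩) hKB)
  rw [μ.apply_eq_iInf]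
  exact le_iInf₂ fun U hU => (measure_mono hU).trans (h U)

theorem maxMeasure_eq_zero {μ : DTM X} (h : μ.IsProper) : μ.maxMeasure = 0 :=
  h _ inferInstance fun A =>
    (μ.maxMeasure_le_inner (A.2.elim IsOpen.measurableSet IsClosed.measurableSet)).trans
      (μ.inner_le A)

/-- The value of `maxMeasure` on the whole space is an infimum over countable Borel covers, and it
is zero here. Disjointing a cheap cover does not increase its cost, since the inner content is
monotone. -/
theorem IsProper.exists_partition {μ : DTM X} (h : μ.IsProper) {ε : ℝ≥0∞} (hε : ε ≠ 0) :
    ∃ t : ℕ → Set X, (∀ i, MeasurableSet (t i)) ∧ Pairwise (Function.onFun Disjoint t) ∧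
      ⋃ i, t i = univ ∧ ∑' i, μ.inner (t i) < ε := by
  have h0 : μ.maxMeasure univ < ε := by
    rw [maxMeasure_eq_zero h]
    simpa using hε.bot_lt
  rw [maxMeasure, toMeasure_apply _ _ MeasurableSet.univ,
    OuterMeasure.ofFunction_eq_iInf_mem (P := MeasurableSet) _ _ (fun s hs => by simp [hs])] at h0
  simp only [iInf_lt_iff] at h0
  obtain ⟨t, ht, hcov, hlt⟩ := h0
  refine ⟨disjointed t, fun i => MeasurableSet.disjointed ht i, disjoint_disjointed t, ?_, ?_⟩
  · rw [iUnion_disjointed]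
    exact univ_subset_iff.1 hcov
  · refine lt_of_le_of_lt (ENNReal.tsum_le_tsum fun i => ?_) hlt
    simp only [ht i, iInf_pos]
    exact μ.inner_mono (disjointed_subset t i)

theorem IsProper.zero : (0 : DTM X).IsProper := by
  intro m _ h
  refine Measure.measure_univ_eq_zero.1 (le_antisymm ?_ zero_le)
  exact (h (OCSet.ofOpen ⊤)).trans (zero_ofOpen _).le

theorem IsProper.smul {μ : DTM X} (hμ : μ.IsProper) (c : NNReal) : (c • μ).IsProper := by
  intro m hm h
  rcases eq_or_ne c 0 with rfl | hc
  · refine Measure.measure_univ_eq_zero.1 (le_antisymm ?_ zero_le)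
    refine (h (OCSet.ofOpen ⊤)).trans ?_
    rw [smul_ofOpen]
    simp
  · have key : c⁻¹ • m = 0 := by
      refine hμ _ inferInstance fun A => ?_
      rw [μ.apply_eq_iInf A]
      refine le_iInf₂ fun U hU => (measure_mono hU).trans ?_
      have h1 := h (OCSet.ofOpen U)
      rw [smul_ofOpen] at h1
      rw [Measure.smul_apply]
      calc c⁻¹ • m (U : Set X) ≤ c⁻¹ • ((c : ℝ≥0∞) * μ (OCSet.ofOpen U)) := by gcongr; exact h1
        _ = μ (OCSet.ofOpen U) := by
          rw [ENNReal.smul_def, smul_eq_mul, ← mul_assoc, ← ENNReal.coe_mul, inv_mul_cancel₀ hc]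
          simp
    calc m = c • (c⁻¹ • m) := by rw [smul_smul, mul_inv_cancel₀ hc, one_smul]
      _ = 0 := by rw [key, smul_zero]

/-- On the refinement `t i ∩ s j` of cheap partitions for `μ` and `ν`, the measure is at most the
sum of the two inner contents. Summing the first over `j` and the second over `i`, superadditivity
returns the costs of the two original partitions. -/
theorem IsProper.add {μ ν : DTM X} (hμ : μ.IsProper) (hν : ν.IsProper) : (μ + ν).IsProper := by
  intro m hm hle
  have hm' : ∀ B, MeasurableSet B → m B ≤ μ.inner B + ν.inner B := fun B hB =>
    ((μ + ν).measure_le_inner (fun U => hle (OCSet.ofOpen U)) hB).trans (μ.inner_add_le ν B)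
  refine Measure.measure_univ_eq_zero.1 (le_antisymm ?_ zero_le)
  refine ENNReal.le_of_forall_pos_le_add fun (δ : NNReal) hδ _ => ?_
  set ε : ℝ≥0∞ := (δ : ℝ≥0∞) with hεδ
  have hε : 0 < ε := ENNReal.coe_pos.2 hδ
  obtain ⟨t, htm, htd, htu, ht⟩ := hμ.exists_partition (ENNReal.half_pos hε.ne').ne'
  obtain ⟨s, hsm, hsd, hsu, hs⟩ := hν.exists_partition (ENNReal.half_pos hε.ne').ne'
  have hcov : (univ : Set X) ⊆ ⋃ p : ℕ × ℕ, t p.1 ∩ s p.2 := by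
    intro x _
    obtain ⟨i, hi⟩ := mem_iUnion.1 (htu ▸ mem_univ x)
    obtain ⟨j, hj⟩ := mem_iUnion.1 (hsu ▸ mem_univ x)
    exact mem_iUnion.2 ⟨(i, j), hi, hj⟩
  calc m univ ≤ ∑' p : ℕ × ℕ, m (t p.1 ∩ s p.2) :=
        (measure_mono hcov).trans (measure_iUnion_le _)
    _ ≤ ∑' p : ℕ × ℕ, (μ.inner (t p.1 ∩ s p.2) + ν.inner (t p.1 ∩ s p.2)) :=
        ENNReal.tsum_le_tsum fun p => hm' _ ((htm p.1).inter (hsm p.2))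
    _ = ∑' i, ∑' j, μ.inner (t i ∩ s j) + ∑' j, ∑' i, ν.inner (t i ∩ s j) := by
        rw [ENNReal.tsum_add, ENNReal.tsum_prod (f := fun i j => μ.inner (t i ∩ s j)),
          ENNReal.tsum_prod (f := fun i j => ν.inner (t i ∩ s j)),
          ENNReal.tsum_comm (f := fun i j => ν.inner (t i ∩ s j))]
    _ ≤ ∑' i, μ.inner (t i) + ∑' j, ν.inner (s j) := by
        refine add_le_add (ENNReal.tsum_le_tsum fun i => ?_) (ENNReal.tsum_le_tsum fun j => ?_)
        · exact (μ.tsum_inner_le fun a b hab => (hsd hab).mono inter_subset_right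
            inter_subset_right).trans (μ.inner_mono (iUnion_subset fun j => inter_subset_left))
        · exact (ν.tsum_inner_le fun a b hab => (htd hab).mono inter_subset_left
            inter_subset_left).trans (ν.inner_mono (iUnion_subset fun i => inter_subset_right))
    _ ≤ ε / 2 + ε / 2 := add_le_add ht.le hs.le
    _ = 0 + ε := by rw [ENNReal.add_halves, zero_add]

end MaxMeasure

/-! ### Splitting into a Radon part and a proper part -/

section Decomposition

variable {X : Type*} [TopologicalSpace X] [T2Space X] [MeasurableSpace X] [BorelSpace X]

/-- The difference of a deficient topological measure and a finite Radon measure below it. -/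
noncomputable def subMeasure (μ : DTM X) (m : Measure X) [IsFiniteMeasure m] [m.Regular]
    (h : ∀ B, MeasurableSet B → m B ≤ μ.inner B) : DTM X :=
  have hc : ∀ K : Compacts X, m K ≤ μ (OCSet.ofCompact K) := fun K =>
    (h K K.isCompact.measurableSet).trans (μ.inner_le (OCSet.ofCompact K))
  have ho : ∀ U : Opens X, m U ≤ μ (OCSet.ofOpen U) := fun U =>
    (h U U.isOpen.measurableSet).trans (μ.inner_le (OCSet.ofOpen U))
  ofOpensCompacts (fun U => μ (OCSet.ofOpen U) - m U) (fun K => μ (OCSet.ofCompact K) - m K)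
    (fun C K hd => by
      rw [μ.add_compact C K hd, Compacts.coe_sup, measure_union hd K.isCompact.measurableSet,
        (ENNReal.cancel_of_ne (measure_ne_top m _)).tsub_add_tsub_comm
          (ENNReal.cancel_of_ne (measure_ne_top m _)) (hc C) (hc K)])
    (fun K U hKU => by
      -- This is where a bound by the inner content on all Borel sets is needed: it applies to `U \
      -- K` and gives `μ K + m (U \ K) ≤ μ U`.
      rw [tsub_le_iff_right, ENNReal.sub_add_eq_add_sub (ho U) (measure_ne_top _ _)]
      refine ENNReal.le_sub_of_add_le_right (measure_ne_top _ _) ?_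
      have h1 : m (U : Set X) = m (K : Set X) + m ((U : Set X) \ K) := by
        rw [← measure_union disjoint_sdiff_right (U.isOpen.measurableSet.diff
          K.isCompact.measurableSet), union_sdiff_cancel hKU]
      have h2 : μ (OCSet.ofCompact K) + m ((U : Set X) \ K) ≤ μ (OCSet.ofOpen U) :=
        calc μ (OCSet.ofCompact K) + m ((U : Set X) \ K)
            ≤ μ.inner (K : Set X) + μ.inner ((U : Set X) \ K) :=
              add_le_add (μ.le_inner subset_rfl)
                (h _ (U.isOpen.measurableSet.diff K.isCompact.measurableSet))
          _ ≤ μ.inner (U : Set X) := by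
              refine (μ.inner_add_inner_le disjoint_sdiff_right).trans (μ.inner_mono ?_)
              rw [union_sdiff_cancel hKU]
          _ ≤ _ := μ.inner_le (OCSet.ofOpen U)
      rw [h1, add_left_comm, add_comm]
      exact add_le_add h2 le_rfl)
    (fun U => by
      rw [μ.inner_regular U]
      simp only [ENNReal.iSup_sub]
      exact iSup₂_mono fun K hK => tsub_le_tsub_left (measure_mono hK) _)
    (fun K => by
      refine ENNReal.le_sub_of_add_le_right (measure_ne_top _ _) ?_
      rw [μ.apply_eq_iInf (OCSet.ofCompact K)]
      refine le_iInf₂ fun U hU => ?_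
      refine (add_le_add (iInf₂_le U hU) (measure_mono hU)).trans ?_
      rw [tsub_add_cancel_of_le (ho U)])
    (tsub_le_self.trans_lt (μ.lt_top _))

variable {μ : DTM X} {m : Measure X} [IsFiniteMeasure m] [m.Regular]
  {h : ∀ B, MeasurableSet B → m B ≤ μ.inner B}

theorem subMeasure_apply {A : OCSet X} (hA : IsCompact (A : Set X) ∨ IsOpen (A : Set X)) :
    μ.subMeasure m h A = μ A - m (A : Set X) :=
  apply_of_compact_or_open (p := fun A => μ.subMeasure m h A = μ A - m (A : Set X)) hA
    (fun U => by rw [subMeasure, ofOpensCompacts_ofOpen]; rfl)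
    (fun K => by rw [subMeasure, ofOpensCompacts_ofCompact]; rfl)

theorem IsTopologicalMeasure.subMeasure (hμ : μ.IsTopologicalMeasure) :
    (μ.subMeasure m h).IsTopologicalMeasure := by
  intro A B C hd hU hA hB hC
  have hm : ∀ D : OCSet X, MeasurableSet (D : Set X) := fun D =>
    D.2.elim IsOpen.measurableSet IsClosed.measurableSet
  rw [subMeasure_apply hA, subMeasure_apply hB, subMeasure_apply hC, hμ A B C hd hU hA hB hC, hU,
    measure_union hd (hm B), (ENNReal.cancel_of_ne (measure_ne_top m _)).tsub_add_tsub_comm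
      (ENNReal.cancel_of_ne (measure_ne_top m _)) ((h _ (hm A)).trans (μ.inner_le A))
      ((h _ (hm B)).trans (μ.inner_le B))]

/-- Every finite deficient topological measure is the sum of a Radon measure and a proper
deficient topological measure, which is a topological measure if the given one is. -/
theorem exists_measure_add_proper (μ : DTM X) :
    ∃ ρ ∈ finiteM X, ∃ ν : DTM X, ν.IsProper ∧
      (μ.IsTopologicalMeasure → ν.IsTopologicalMeasure) ∧ pairing μ = pairing ρ + pairing ν := by
  have h : ∀ B, MeasurableSet B → μ.maxMeasure B ≤ μ.inner B := fun B => μ.maxMeasure_le_inner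
  have ho : ∀ U : Opens X, μ (OCSet.ofOpen U) =
      μ.maxMeasure U + μ.subMeasure μ.maxMeasure h (OCSet.ofOpen U) := fun U => by
    rw [subMeasure_apply (Or.inr U.isOpen)]
    exact (add_tsub_cancel_of_le
      ((h _ U.isOpen.measurableSet).trans (μ.inner_le (OCSet.ofOpen U)))).symm
  refine ⟨ofMeasure μ.maxMeasure, ⟨μ.maxMeasure, inferInstance, inferInstance, fun _ => rfl⟩,
    μ.subMeasure μ.maxMeasure h, ?_, fun hμ => hμ.subMeasure,
    funext fun f => quasiIntegral_of_ofOpen_eq_add ho f.1⟩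
  intro m hm hle
  have hfin := isFiniteMeasure_of_le _ fun U => hle (OCSet.ofOpen U)
  -- A Radon measure below the difference can be added to `maxMeasure` without exceeding `μ`, so
  -- maximality and finiteness force it to vanish.
  have h1 : m + μ.maxMeasure ≤ μ.maxMeasure := by
    have hr : (m + μ.maxMeasure).Regular := inferInstance
    refine μ.le_maxMeasure fun B hB => μ.measure_le_inner (fun U => ?_) hB
    rw [ho U, Measure.add_apply, add_comm]
    exact add_le_add le_rfl (hle (OCSet.ofOpen U))
  refine Measure.measure_univ_eq_zero.1 ?_
  have h2 : m univ + μ.maxMeasure univ ≤ 0 + μ.maxMeasure univ := by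
    simpa using h1 univ
  exact le_antisymm ((ENNReal.add_le_add_iff_right (measure_ne_top _ _)).1 h2) zero_le

end Decomposition

end DTM

/-- The preimage of an open or closed set under a continuous map. -/
def OCSet.preimage {X Y : Type*} [TopologicalSpace X] [TopologicalSpace Y] {e : Y → X}
    (he : Continuous e) (A : OCSet X) : OCSet Y :=
  ⟨e ⁻¹' A, A.2.imp (fun h => h.preimage he) (fun h => h.preimage he)⟩

theorem Topology.IsClosedEmbedding.regular_comap {X Y : Type*} [TopologicalSpace X] [T2Space X]
    [MeasurableSpace X] [BorelSpace X] [TopologicalSpace Y] [T2Space Y] [MeasurableSpace Y]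
    [BorelSpace Y] {e : Y → X} (he : IsClosedEmbedding e) (m : Measure X) [IsFiniteMeasure m]
    [H : m.InnerRegular] : (m.comap e).Regular := by
  have : IsFiniteMeasure (m.comap e) := ⟨by
    rw [he.measurableEmbedding.comap_apply]
    exact measure_lt_top _ _⟩
  have : (m.comap e).InnerRegular :=
    ⟨H.innerRegular.comap he.measurableEmbedding
      (fun _ hU => he.measurableEmbedding.measurableSet_image' hU)
      (fun _ _ hK => he.isCompact_preimage hK)⟩
  infer_instance

namespace DTM

/-! ### Images under closed embeddings -/

section Push

variable {X Y : Type*} [TopologicalSpace X] [T2Space X] [TopologicalSpace Y] [T2Space Y]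
  {e : Y → X}

theorem exists_open_preimage_eq (he : IsClosedEmbedding e) (V : Opens Y) :
    ∃ U : Opens X, e ⁻¹' (U : Set X) = V ∧ (range e)ᶜ ⊆ (U : Set X) := by
  refine ⟨⟨(e '' (V : Set Y)ᶜ)ᶜ, (he.isClosedMap _ V.isOpen.isClosed_compl).isOpen_compl⟩, ?_, ?_⟩
  · simp [preimage_image_eq _ he.injective]
  · exact compl_subset_compl.2 (image_subset_range _ _)

/-- The image of a deficient topological measure under a closed embedding. -/
noncomputable def push (he : IsClosedEmbedding e) (ν : DTM Y) : DTM X where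
  toFun A := ν (A.preimage he.continuous)
  add_compact C K h :=
    (congrArg ν.toFun (Subtype.ext rfl)).trans
      (ν.add_compact ⟨e ⁻¹' C, he.isCompact_preimage C.isCompact⟩
        ⟨e ⁻¹' K, he.isCompact_preimage K.isCompact⟩ (h.preimage e))
  inner_regular U := by
    refine le_antisymm ?_ (iSup₂_le fun K hK => ν.mono (preimage_mono hK))
    refine (ν.inner_regular ⟨e ⁻¹' U, U.isOpen.preimage he.continuous⟩).le.trans
      (iSup₂_le fun K hK => ?_)
    refine le_iSup₂_of_le (K.map e he.continuous) (image_subset_iff.2 hK) (ν.mono ?_)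
    exact subset_preimage_image e _
  outer_regular F := by
    refine le_antisymm (le_iInf₂ fun U hU => ν.mono (preimage_mono hU)) ?_
    rw [ν.apply_eq_iInf]
    refine le_iInf₂ fun V hV => ?_
    obtain ⟨U, hU, hr⟩ := exists_open_preimage_eq he V
    refine iInf₂_le_of_le U (fun x hx => ?_) (ν.mono hU.le)
    by_cases h : x ∈ range e
    · obtain ⟨y, rfl⟩ := h
      exact hU.ge (hV hx)
    · exact hr h
  finite := ν.lt_top _

theorem push_apply (he : IsClosedEmbedding e) (ν : DTM Y) (A : OCSet X) :
    push he ν A = ν (A.preimage he.continuous) := rfl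

theorem IsTopologicalMeasure.push (he : IsClosedEmbedding e) {ν : DTM Y}
    (hν : ν.IsTopologicalMeasure) : (push he ν).IsTopologicalMeasure := by
  intro A B C hd hU hA hB hC
  have key : ∀ A : OCSet X, (IsCompact (A : Set X) ∨ IsOpen (A : Set X)) →
      (IsCompact (A.preimage he.continuous : Set Y) ∨ IsOpen (A.preimage he.continuous : Set Y)) :=
    fun A hA => hA.imp (fun h => he.isCompact_preimage h) (fun h => h.preimage he.continuous)
  refine hν (A.preimage he.continuous) (B.preimage he.continuous) (C.preimage he.continuous)
    (hd.preimage e) ?_ (key A hA) (key B hB) (key C hC)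
  change e ⁻¹' (C : Set X) = _
  rw [hU]
  rfl

/-- The restriction of `m` to the closed range pulls back to a Radon measure below `ν`, hence
vanishes. The complement of the range is open and its image mass is that of the empty set. -/
theorem IsProper.push [MeasurableSpace X] [BorelSpace X] [MeasurableSpace Y] [BorelSpace Y]
    (he : IsClosedEmbedding e) {ν : DTM Y} (hν : ν.IsProper) : (push he ν).IsProper := by
  intro m hm hle
  have hfin := isFiniteMeasure_of_le _ fun U => hle (OCSet.ofOpen U)
  have hr := he.regular_comap m
  have h0 : m.comap e = 0 := by
    refine hν _ hr fun A => ?_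
    rw [ν.apply_eq_iInf]
    refine le_iInf₂ fun V hV => ?_
    obtain ⟨U, hU, -⟩ := exists_open_preimage_eq he V
    rw [he.measurableEmbedding.comap_apply]
    refine (measure_mono (image_subset_iff.2 (hV.trans hU.ge))).trans ?_
    exact (hle (OCSet.ofOpen U)).trans (ν.mono hU.le)
  have h1 : m (range e) = 0 := by
    rw [← image_univ, ← he.measurableEmbedding.comap_apply, h0]
    rfl
  have h2 : m (range e)ᶜ = 0 := by
    refine le_antisymm ((hle (OCSet.ofOpen ⟨(range e)ᶜ, he.isClosed_range.isOpen_compl⟩)).trans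
      ?_) zero_le
    rw [push_apply, ν.apply_eq_zero_of_eq_empty]
    simp [OCSet.preimage, OCSet.ofOpen]
  refine Measure.measure_univ_eq_zero.1 (le_antisymm ?_ zero_le)
  rw [← union_compl_self (range e)]
  exact (measure_union_le _ _).trans (by rw [h1, h2, add_zero])

/-- The composition of a function vanishing at infinity and a closed embedding. -/
noncomputable def restrictTest (he : IsClosedEmbedding e) (f : TestFunction X) : TestFunction Y :=
  ⟨f.1.comp ⟨⟨e, he.continuous⟩, he.tendsto_cocompact⟩, fun y => f.2 (e y)⟩

theorem pairing_push (he : IsClosedEmbedding e) (ν : DTM Y) (f : TestFunction X) :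
    pairing (push he ν) f = pairing ν (restrictTest he f) :=
  quasiIntegral_congr fun _ _ => rfl

/-- Pairing an image with `f` amounts to pairing the original with `f ∘ e`, so on pairings the
push-forward is a reindexing of coordinates, which is continuous. -/
theorem push_mem_closure (he : IsClosedEmbedding e) {S : Set (DTM Y)} {T : Set (DTM X)}
    (h : ∀ ν ∈ S, push he ν ∈ T) {ν : DTM Y} (hν : ν ∈ closure S) : push he ν ∈ closure T := by
  rw [mem_closure_iff_pairing] at hν ⊢
  have hR : Continuous fun (φ : TestFunction Y → ℝ) (f : TestFunction X) => φ (restrictTest he f) :=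
    continuous_pi fun f => continuous_apply _
  have := map_mem_closure hR hν (t := pairing '' T) (by
    rintro _ ⟨ν, hν, rfl⟩
    exact ⟨push he ν, h ν hν, funext fun f => pairing_push he ν f⟩)
  convert this using 1
  exact funext (pairing_push he ν)

end Push

/-! ### Restrictions along open embeddings -/

section Comap

variable {Y Z : Type*} [TopologicalSpace Y] [T2Space Y] [TopologicalSpace Z] [T2Space Z]
  {e : Y → Z}

/-- The restriction of a deficient topological measure along an open embedding. -/
noncomputable def comap (he : IsOpenEmbedding e) (μ : DTM Z) : DTM Y :=
  ofOpensCompacts (fun U => μ (OCSet.ofOpen ⟨e '' U, he.isOpenMap _ U.isOpen⟩))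
    (fun K => μ (OCSet.ofCompact (K.map e he.continuous)))
    (fun C K h => by
      rw [← μ.add_compact _ _ ((disjoint_image_iff he.injective).2 h)]
      congr 2
      exact Compacts.ext (image_union e C K))
    (fun K U h => μ.mono (image_mono h))
    (fun U => by
      rw [μ.inner_regular]
      refine iSup₂_le fun K hK => ?_
      have hr : (K : Set Z) ⊆ range e := hK.trans (image_subset_range _ _)
      refine le_iSup₂_of_le ⟨e ⁻¹' K, he.isInducing.isCompact_preimage' K.isCompact hr⟩ ?_
        (μ.mono ?_)
      · refine (preimage_mono hK).trans ?_
        exact (preimage_image_eq _ he.injective).le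
      · exact (image_preimage_eq_of_subset hr).ge)
    (fun K => by
      rw [μ.apply_eq_iInf (OCSet.ofCompact _)]
      refine le_iInf₂ fun V hV => iInf₂_le_of_le ⟨e ⁻¹' V, V.isOpen.preimage he.continuous⟩
        ((image_subset_iff (f := e)).1 hV) (μ.mono (image_preimage_subset e V)))
    (μ.lt_top _)

theorem comap_ofOpen (he : IsOpenEmbedding e) (μ : DTM Z) (U : Opens Y) :
    comap he μ (OCSet.ofOpen U) = μ (OCSet.ofOpen ⟨e '' U, he.isOpenMap _ U.isOpen⟩) := by
  rw [comap, ofOpensCompacts_ofOpen]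

theorem comap_ofCompact (he : IsOpenEmbedding e) (μ : DTM Z) (K : Compacts Y) :
    comap he μ (OCSet.ofCompact K) = μ (OCSet.ofCompact (K.map e he.continuous)) := by
  rw [comap, ofOpensCompacts_ofCompact]

theorem IsTopologicalMeasure.comap (he : IsOpenEmbedding e) {μ : DTM Z}
    (hμ : μ.IsTopologicalMeasure) : (comap he μ).IsTopologicalMeasure := by
  intro A B C hd hU hA hB hC
  have key : ∀ A : OCSet Y, (IsCompact (A : Set Y) ∨ IsOpen (A : Set Y)) →
      ∃ A' : OCSet Z, (A' : Set Z) = e '' A ∧ (IsCompact (A' : Set Z) ∨ IsOpen (A' : Set Z)) ∧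
        DTM.comap he μ A = μ A' := by
    rintro A (h | h)
    · exact ⟨OCSet.ofCompact ((⟨A, h⟩ : Compacts Y).map e he.continuous), rfl,
        Or.inl (h.image he.continuous), comap_ofCompact he μ ⟨A, h⟩⟩
    · exact ⟨OCSet.ofOpen ⟨e '' A, he.isOpenMap _ h⟩, rfl, Or.inr (he.isOpenMap _ h),
        comap_ofOpen he μ ⟨A, h⟩⟩
  obtain ⟨A', hA', hA'', hAe⟩ := key A hA
  obtain ⟨B', hB', hB'', hBe⟩ := key B hB
  obtain ⟨C', hC', hC'', hCe⟩ := key C hC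
  rw [hAe, hBe, hCe]
  refine hμ A' B' C' ?_ ?_ hA'' hB'' hC''
  · rw [hA', hB']
    exact (disjoint_image_iff he.injective).2 hd
  · rw [hA', hB', hC', hU, image_union]

end Comap

/-! ### Closed additive monoids of pairings and countable closed covers -/

section Closure

variable {X : Type*} [TopologicalSpace X] [T2Space X]

/-- The closure of the set of pairings of a family that is closed under addition. -/
noncomputable def pairingClosure (S : Set (DTM X)) (h0 : 0 ∈ S)
    (hadd : ∀ μ ∈ S, ∀ ν ∈ S, μ + ν ∈ S) : AddSubmonoid (TestFunction X → ℝ) :=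
  AddSubmonoid.topologicalClosure
    { carrier := pairing '' S
      zero_mem' := ⟨0, h0, pairing_zero⟩
      add_mem' := by
        rintro _ _ ⟨μ, hμ, rfl⟩ ⟨ν, hν, rfl⟩
        exact ⟨μ + ν, hadd μ hμ ν hν, pairing_add μ ν⟩ }

theorem mem_pairingClosure {S : Set (DTM X)} {h0 : 0 ∈ S}
    {hadd : ∀ μ ∈ S, ∀ ν ∈ S, μ + ν ∈ S} {μ : DTM X} :
    pairing μ ∈ pairingClosure S h0 hadd ↔ μ ∈ closure S :=
  mem_closure_iff_pairing.symm

theorem isClosed_pairingClosure {S : Set (DTM X)} {h0 : 0 ∈ S}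
    {hadd : ∀ μ ∈ S, ∀ ν ∈ S, μ + ν ∈ S} :
    IsClosed (pairingClosure S h0 hadd : Set (TestFunction X → ℝ)) := isClosed_closure

/-- If a space is a countable union of compact subsets, a family of set functions on it that is
closed under addition and contains the images of dense families on the subsets is dense in the
Radon measures. -/
theorem finiteM_subset_closure_of_iUnion [MeasurableSpace X] [BorelSpace X] {Xi : ℕ → Set X}
    (hcover : ⋃ i, Xi i = univ) (hc : ∀ i, IsClosed (Xi i)) {S : Set (DTM X)} (h0 : 0 ∈ S)
    (hadd : ∀ μ ∈ S, ∀ ν ∈ S, μ + ν ∈ S) {T : ∀ i, Set (DTM (Xi i))}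
    (hT : ∀ i, finiteM (Xi i) ⊆ closure (T i))
    (hpush : ∀ i, ∀ ν ∈ T i, push (hc i).isClosedEmbedding_subtypeVal ν ∈ S) :
    finiteM X ⊆ closure S := by
  rintro μ ⟨m, hfin, hreg, hμ⟩
  rw [← mem_pairingClosure (h0 := h0) (hadd := hadd)]
  have hmeas : ∀ i, MeasurableSet (disjointed Xi i) := fun i =>
    MeasurableSet.disjointed (fun i => (hc i).measurableSet) i
  have key : ∀ i, ∃ ρ : DTM X, ρ ∈ closure S ∧
      ∀ U : Opens X, ρ (OCSet.ofOpen U) = m.restrict (disjointed Xi i) U := by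
    intro i
    have hi := (hc i).isClosedEmbedding_subtypeVal
    have hr : (m.restrict (disjointed Xi i)).InnerRegular := inferInstance
    have hr' := hi.regular_comap (m.restrict (disjointed Xi i))
    have hf' : IsFiniteMeasure ((m.restrict (disjointed Xi i)).comap ((↑) : Xi i → X)) := by
      constructor
      rw [hi.measurableEmbedding.comap_apply]
      exact measure_lt_top _ _
    -- The restricted measure is carried by `disjointed Xi i ⊆ Xi i`, so pulling it back to `Xi i`
    -- and pushing it forward again loses no mass.
    refine ⟨push hi (ofMeasure ((m.restrict (disjointed Xi i)).comap ((↑) : Xi i → X))),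
      push_mem_closure hi (hpush i) (hT i ⟨_, hf', hr', fun _ => rfl⟩), fun U => ?_⟩
    change ((m.restrict (disjointed Xi i)).comap ((↑) : Xi i → X)) (((↑) : Xi i → X) ⁻¹' U) = _
    rw [hi.measurableEmbedding.comap_apply, Subtype.image_preimage_coe,
      Measure.restrict_apply U.isOpen.measurableSet,
      Measure.restrict_apply ((hc i).measurableSet.inter U.isOpen.measurableSet)]
    congr 1
    ext x
    have := fun hx : x ∈ disjointed Xi i => disjointed_subset Xi i hx
    simp only [mem_inter_iff]
    tauto
  choose ρ hρ hρm using key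
  have hsum : ∀ n, ∑ i ∈ Finset.range n, pairing (ρ i) ∈ pairingClosure S h0 hadd := fun n =>
    sum_mem fun i _ => mem_pairingClosure.2 (hρ i)
  refine (isClosed_pairingClosure (h0 := h0) (hadd := hadd)).mem_of_tendsto
    (b := Filter.atTop) (tendsto_pi_nhds.2 fun f => ?_) (Filter.Eventually.of_forall hsum)
  have hint := f.1.integrable_of_isFiniteMeasure m
  -- Countable additivity of the integral over the disjoint pieces is the required convergence of
  -- partial sums, one test function at a time.
  have h := (hasSum_integral_iUnion hmeas (disjoint_disjointed Xi)
    (hint.integrableOn (s := ⋃ i, disjointed Xi i))).tendsto_sum_nat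
  rw [iUnion_disjointed, hcover, Measure.restrict_univ,
    ← quasiIntegral_eq_integral (μ := μ) (fun U => hμ (OCSet.ofOpen U)) f.2] at h
  refine h.congr fun n => ?_
  rw [Finset.sum_apply]
  exact Finset.sum_congr rfl fun i _ => (quasiIntegral_eq_integral (hρm i) f.2).symm

end Closure

end DTM

/-! ### Connected sets in locally connected spaces -/

section ConnectedSets

variable {Z : Type*} [TopologicalSpace Z] [T2Space Z] [LocallyConnectedSpace Z]

theorem exists_isCompact_isPreconnected_mem_nhds [LocallyCompactSpace Z] {U : Set Z} {x : Z}
    (hU : U ∈ 𝓝 x) : ∃ L ∈ 𝓝 x, IsCompact L ∧ IsPreconnected L ∧ L ⊆ U := by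
  obtain ⟨K, hK, hKU, hKc⟩ := local_compact_nhds hU
  have hx : x ∈ interior K := mem_interior_iff_mem_nhds.2 hK
  have hcl : closure (connectedComponentIn (interior K) x) ⊆ K :=
    closure_minimal ((connectedComponentIn_subset _ _).trans interior_subset) hKc.isClosed
  refine ⟨closure (connectedComponentIn (interior K) x), ?_, hKc.of_isClosed_subset isClosed_closure
    hcl, isPreconnected_connectedComponentIn.closure, hcl.trans hKU⟩
  exact Filter.mem_of_superset
    (isOpen_interior.connectedComponentIn.mem_nhds (mem_connectedComponentIn hx)) subset_closure

/-- In a locally compact, locally connected Hausdorff space, every compact subset of a connected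
open set lies in a compact connected subset of it. -/
theorem IsPreconnected.exists_isCompact_isPreconnected_superset [LocallyCompactSpace Z] {G K : Set Z}
    (hGc : IsPreconnected G) (hG : IsOpen G) (hK : IsCompact K) (hKG : K ⊆ G) :
    ∃ L, IsCompact L ∧ IsPreconnected L ∧ K ⊆ L ∧ L ⊆ G := by
  rcases K.eq_empty_or_nonempty with rfl | ⟨x₀, hx₀⟩
  · exact ⟨∅, isCompact_empty, isPreconnected_empty, subset_rfl, empty_subset _⟩
  have hpair : ∀ y ∈ G, ∃ L, IsCompact L ∧ IsPreconnected L ∧ x₀ ∈ L ∧ y ∈ L ∧ L ⊆ G := by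
    intro y hy
    -- Lying in a common compact connected subset of `G` is a symmetric and transitive relation that
    -- holds locally, so it holds throughout the connected set `G`.
    refine hGc.induction₂ (fun a b => ∃ L, IsCompact L ∧ IsPreconnected L ∧ a ∈ L ∧ b ∈ L ∧ L ⊆ G)
      ?_ ?_ ?_ (hKG hx₀) hy
    · intro x hx
      obtain ⟨L, hL, hLc, hLp, hLG⟩ := exists_isCompact_isPreconnected_mem_nhds (hG.mem_nhds hx)
      filter_upwards [mem_nhdsWithin_of_mem_nhds hL] with z hz
      exact ⟨L, hLc, hLp, mem_of_mem_nhds hL, hz, hLG⟩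
    · rintro x y z - - - ⟨L, hLc, hLp, hxL, hyL, hLG⟩ ⟨M, hMc, hMp, hyM, hzM, hMG⟩
      exact ⟨L ∪ M, hLc.union hMc, hLp.union y hyL hyM hMp, Or.inl hxL, Or.inr hzM,
        union_subset hLG hMG⟩
    · rintro x y - - ⟨L, hLc, hLp, hxL, hyL, hLG⟩
      exact ⟨L, hLc, hLp, hyL, hxL, hLG⟩
  have key : ∃ L, IsCompact L ∧ IsPreconnected L ∧ x₀ ∈ L ∧ K ⊆ L ∧ L ⊆ G := by
    refine hK.induction_on
      (p := fun s => ∃ L, IsCompact L ∧ IsPreconnected L ∧ x₀ ∈ L ∧ s ⊆ L ∧ L ⊆ G) ?_ ?_ ?_ ?_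
    · exact ⟨{x₀}, isCompact_singleton, isPreconnected_singleton, rfl, empty_subset _,
        singleton_subset_iff.2 (hKG hx₀)⟩
    · rintro s t hst ⟨L, hLc, hLp, hxL, htL, hLG⟩
      exact ⟨L, hLc, hLp, hxL, hst.trans htL, hLG⟩
    · rintro s t ⟨L, hLc, hLp, hxL, hsL, hLG⟩ ⟨M, hMc, hMp, hxM, htM, hMG⟩
      exact ⟨L ∪ M, hLc.union hMc, hLp.union x₀ hxL hxM hMp, Or.inl hxL,
        union_subset_union hsL htM, union_subset hLG hMG⟩
    · intro y hy
      obtain ⟨L, hLc, hLp, hxL, hyL, hLG⟩ := hpair y (hKG hy)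
      obtain ⟨M, hM, hMc, hMp, hMG⟩ :=
        exists_isCompact_isPreconnected_mem_nhds (hG.mem_nhds (hKG hy))
      exact ⟨M, mem_nhdsWithin_of_mem_nhds hM, L ∪ M, hLc.union hMc,
        hLp.union y hyL (mem_of_mem_nhds hM) hMp, Or.inl hxL, subset_union_right,
        union_subset hLG hMG⟩
  obtain ⟨L, hLc, hLp, -, hKL, hLG⟩ := key
  exact ⟨L, hLc, hLp, hKL, hLG⟩

theorem connectedComponentIn_eq_or_disjoint {α : Type*} [TopologicalSpace α] (F : Set α) (x y : α) :
    connectedComponentIn F x = connectedComponentIn F y ∨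
      Disjoint (connectedComponentIn F x) (connectedComponentIn F y) := by
  by_cases h : Disjoint (connectedComponentIn F x) (connectedComponentIn F y)
  · exact Or.inr h
  · obtain ⟨z, hx, hy⟩ := not_disjoint_iff.1 h
    exact Or.inl ((connectedComponentIn_eq hx).trans (connectedComponentIn_eq hy).symm)

/-- In a connected, locally connected space, the complement of a component of the complement of a
nonempty closed connected set is connected. -/
theorem isPreconnected_compl_connectedComponentIn_compl [PreconnectedSpace Z] {D : Set Z}
    (hDp : IsPreconnected D) (hD : IsClosed D) (hne : D.Nonempty) (x : Z) :
    IsPreconnected (connectedComponentIn Dᶜ x)ᶜ := by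
  obtain ⟨d, hd⟩ := hne
  have hDV : D ⊆ (connectedComponentIn Dᶜ x)ᶜ :=
    subset_compl_comm.1 (connectedComponentIn_subset _ _)
  refine isPreconnected_of_forall d fun y hy => ?_
  by_cases hyD : y ∈ D
  · exact ⟨D, hDV, hd, hyD, hDp⟩
  set W := connectedComponentIn Dᶜ y with hW
  have hyW : y ∈ W := mem_connectedComponentIn hyD
  have hWD : W ⊆ Dᶜ := connectedComponentIn_subset _ _
  -- A component of `Dᶜ` whose closure missed `D` would be clopen, hence everything. So each of the
  -- other components can be attached to `D` through a limit point.
  have hmeet : (closure W ∩ D).Nonempty := by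
    by_contra h
    have hsub : closure W ⊆ Dᶜ := fun z hz hzD => h ⟨z, hz, hzD⟩
    have hcl : closure W ⊆ W :=
      isPreconnected_connectedComponentIn.closure.subset_connectedComponentIn
        (subset_closure hyW) hsub
    have hclosed : IsClosed W := closure_subset_iff_isClosed.1 hcl
    have huniv := IsClopen.eq_univ ⟨hclosed, hD.isOpen_compl.connectedComponentIn⟩ ⟨y, hyW⟩
    exact hWD (huniv ▸ mem_univ d) hd
  obtain ⟨z, hzW, hzD⟩ := hmeet
  have hWz : IsPreconnected (insert z W) :=
    isPreconnected_connectedComponentIn.subset_closure (subset_insert _ _)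
      (insert_subset hzW subset_closure)
  refine ⟨insert z W ∪ D, ?_, Or.inr hd, Or.inl (mem_insert_of_mem _ hyW),
    hWz.union z (mem_insert _ _) hzD hDp⟩
  refine union_subset (insert_subset (hDV hzD) ?_) hDV
  rcases connectedComponentIn_eq_or_disjoint Dᶜ y x with h | h
  · exact absurd (h ▸ hyW : y ∈ connectedComponentIn Dᶜ x) hy
  · exact h.subset_compl_right

/-- The complements of two intersecting components of the complements of disjoint connected sets
are nested or disjoint. -/
theorem compl_connectedComponentIn_nested_or_disjoint [PreconnectedSpace Z] {D E : Set Z}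
    (hDp : IsPreconnected D) (hD : IsClosed D) (hDne : D.Nonempty) (hEp : IsPreconnected E)
    (hDE : Disjoint D E) {x y q : Z} (hx : q ∈ connectedComponentIn Dᶜ x)
    (hy : q ∈ connectedComponentIn Eᶜ y) :
    (connectedComponentIn Dᶜ x)ᶜ ⊆ (connectedComponentIn Eᶜ y)ᶜ ∨
      (connectedComponentIn Eᶜ y)ᶜ ⊆ (connectedComponentIn Dᶜ x)ᶜ ∨
        Disjoint (connectedComponentIn Dᶜ x)ᶜ (connectedComponentIn Eᶜ y)ᶜ := by
  -- A connected `B` disjoint from `A` either lies in the component of `Aᶜ` through `q` or misses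
  -- it. In the latter case that component is a connected subset of `Bᶜ` through `q`.
  have hsub : ∀ {A B : Set Z} {a b : Z}, IsPreconnected B → Disjoint A B →
      q ∈ connectedComponentIn Aᶜ a → q ∈ connectedComponentIn Bᶜ b →
      ¬ B ⊆ connectedComponentIn Aᶜ a →
        (connectedComponentIn Bᶜ b)ᶜ ⊆ (connectedComponentIn Aᶜ a)ᶜ := by
    intro A B a b hB hAB ha hb hn
    have hd : Disjoint (connectedComponentIn Aᶜ a) B := by
      by_contra h
      obtain ⟨z, hz, hzB⟩ := not_disjoint_iff.1 h
      apply hn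
      rw [connectedComponentIn_eq hz]
      exact hB.subset_connectedComponentIn hzB hAB.subset_compl_left
    rw [connectedComponentIn_eq hb]
    exact compl_subset_compl.2 (isPreconnected_connectedComponentIn.subset_connectedComponentIn ha
      hd.subset_compl_right)
  by_cases h1 : E ⊆ connectedComponentIn Dᶜ x
  · by_cases h2 : D ⊆ connectedComponentIn Eᶜ y
    · refine Or.inr (Or.inr ?_)
      obtain ⟨d, hd⟩ := hDne
      have hS := isPreconnected_compl_connectedComponentIn_compl hDp hD ⟨d, hd⟩ x
      have hdS : d ∈ (connectedComponentIn Dᶜ x)ᶜ := fun h => connectedComponentIn_subset _ _ h hd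
      have := hS.subset_connectedComponentIn hdS (compl_subset_compl.2 h1)
      rw [← connectedComponentIn_eq (h2 hd)] at this
      exact disjoint_compl_right_iff_subset.2 this
    · exact Or.inl (hsub hDp hDE.symm hy hx h2)
  · exact Or.inr (Or.inl (hsub hEp hDE hx hy h1))

/-- In a locally compact, locally connected Hausdorff space, a compact subset of an open set is
covered by finitely many disjoint compact connected subsets of the open set. -/
theorem IsCompact.exists_finset_isPreconnected_cover [LocallyCompactSpace Z] {F U : Set Z}
    (hF : IsCompact F) (hU : IsOpen U) (hFU : F ⊆ U) :
    ∃ 𝒟 : Finset (Set Z), (∀ D ∈ 𝒟, IsCompact D ∧ IsPreconnected D ∧ D.Nonempty ∧ D ⊆ U) ∧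
      (∀ D ∈ 𝒟, ∀ E ∈ 𝒟, D ≠ E → Disjoint D E) ∧ F ⊆ ⋃ D ∈ 𝒟, D := by
  classical
  have hloc : ∀ x ∈ F, ∃ L ∈ 𝓝 x, IsCompact L ∧ IsPreconnected L ∧ L ⊆ U := fun x hx =>
    exists_isCompact_isPreconnected_mem_nhds (hU.mem_nhds (hFU hx))
  choose! L hL using hloc
  obtain ⟨t, htF, htc⟩ := hF.elim_nhds_subcover L fun x hx => (hL x hx).1
  -- Local neighbourhoods are grouped by the component `V` of `U` that contains them. The choice of
  -- `D` depends on `V` alone, so distinct chosen sets lie in distinct components and are disjoint.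
  have hcore : ∀ V : Set Z, (∃ x ∈ t, connectedComponentIn U x = V) → ∃ D, IsCompact D ∧
      IsPreconnected D ∧ (∀ y ∈ t, connectedComponentIn U y = V → L y ⊆ D) ∧ D ⊆ V := by
    rintro V ⟨x, hx, rfl⟩
    obtain ⟨D, hD, hDp, hKD, hDV⟩ :=
      isPreconnected_connectedComponentIn.exists_isCompact_isPreconnected_superset
        (hU.connectedComponentIn (x := x))
        (K := ⋃ y ∈ {y | y ∈ t ∧ connectedComponentIn U y = connectedComponentIn U x}, L y)
        ((t.finite_toSet.subset fun y hy => hy.1).isCompact_biUnion fun y hy =>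
          (hL y (htF y hy.1)).2.1)
        (iUnion₂_subset fun y hy => by
          obtain ⟨h1, -, h2, h3⟩ := hL y (htF y hy.1)
          exact (h2.subset_connectedComponentIn (mem_of_mem_nhds h1) h3).trans hy.2.subset)
    exact ⟨D, hD, hDp, fun y hy hyx => (subset_biUnion_of_mem (u := fun y => L y)
      (show y ∈ {y | y ∈ t ∧ connectedComponentIn U y = connectedComponentIn U x} from
        ⟨hy, hyx⟩)).trans hKD, hDV⟩
  choose! D hD using hcore
  refine ⟨t.image fun x => D (connectedComponentIn U x), ?_, ?_, ?_⟩
  · intro E hE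
    obtain ⟨x, hx, rfl⟩ := Finset.mem_image.1 hE
    obtain ⟨h1, h2, h3, h4⟩ := hD _ ⟨x, hx, rfl⟩
    exact ⟨h1, h2, ⟨x, h3 x hx rfl (mem_of_mem_nhds (hL x (htF x hx)).1)⟩,
      h4.trans (connectedComponentIn_subset _ _)⟩
  · intro E hE E' hE' hne
    obtain ⟨x, hx, rfl⟩ := Finset.mem_image.1 hE
    obtain ⟨y, hy, rfl⟩ := Finset.mem_image.1 hE'
    rcases connectedComponentIn_eq_or_disjoint U x y with h | h
    · exact absurd (congrArg D h) hne
    · exact h.mono (hD _ ⟨x, hx, rfl⟩).2.2.2 (hD _ ⟨y, hy, rfl⟩).2.2.2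
  · refine htc.trans (iUnion₂_subset fun x hx => ?_)
    exact ((hD _ ⟨x, hx, rfl⟩).2.2.1 x hx rfl).trans (subset_biUnion_of_mem (u := fun T : Set Z => T)
      (Finset.mem_image_of_mem (fun x => D (connectedComponentIn U x)) hx))

end ConnectedSets

/-- A connected compact Hausdorff space that is locally connected away from one point is locally
connected. -/
theorem locallyConnectedSpace_of_isOpen_connectedComponentIn {Z : Type*} [TopologicalSpace Z]
    [T2Space Z] [CompactSpace Z] [PreconnectedSpace Z] (z₀ : Z)
    (h : ∀ O : Set Z, IsOpen O → z₀ ∉ O → ∀ x, IsOpen (connectedComponentIn O x)) :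
    LocallyConnectedSpace Z := by
  have hz : ∀ O : Set Z, IsOpen O → z₀ ∈ O → connectedComponentIn O z₀ ∈ 𝓝 z₀ := by
    classical
    intro O hO hzO
    obtain ⟨N, hN, hNc, hNO⟩ := exists_mem_nhds_isClosed_subset (hO.mem_nhds hzO)
    have hzN : z₀ ∈ interior N := mem_interior_iff_mem_nhds.2 hN
    have hclN : closure (interior N) ⊆ N := closure_minimal interior_subset hNc
    set Q : Set Z := O \ {z₀} with hQ
    have hQo : IsOpen Q := hO.sdiff isClosed_singleton
    have hzQ : z₀ ∉ Q := fun h => h.2 rfl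
    have hfr : frontier (interior N) ⊆ Q := fun w hw =>
      ⟨hNO (hclN hw.1), fun hwz => hw.2 (by rw [isOpen_interior.interior_eq, hwz]; exact hzN)⟩
    obtain ⟨t, -, ht⟩ := isClosed_frontier.isCompact.elim_nhds_subcover
      (fun x => connectedComponentIn Q x) (fun x hx => (h Q hQo hzQ x).mem_nhds
        (mem_connectedComponentIn (hfr hx)))
    -- Finitely many components of `Q` cover the frontier of `interior N`; `B` discards those not
    -- adherent to `z₀`. The component of any remaining `y ≠ z₀` must then accumulate at `z₀`:
    -- otherwise it misses the frontier, stays inside `interior N` and is clopen.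
    set B : Set Z := interior N ∩ ⋂ x ∈ t.filter (fun x => z₀ ∉ closure (connectedComponentIn Q x)),
      (closure (connectedComponentIn Q x))ᶜ with hB
    have hBo : B ∈ 𝓝 z₀ := by
      refine Filter.inter_mem (isOpen_interior.mem_nhds hzN) ?_
      rw [Filter.biInter_finset_mem]
      intro x hx
      exact isClosed_closure.isOpen_compl.mem_nhds (Finset.mem_filter.1 hx).2
    refine Filter.mem_of_superset hBo fun y hy => ?_
    by_cases hyz : y = z₀
    · rw [hyz]
      exact mem_connectedComponentIn hzO
    have hyQ : y ∈ Q := ⟨hNO (interior_subset hy.1), hyz⟩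
    set D := connectedComponentIn Q y with hD
    have hyD : y ∈ D := mem_connectedComponentIn hyQ
    have hDp : IsPreconnected D := isPreconnected_connectedComponentIn
    have hDQ : D ⊆ Q := connectedComponentIn_subset _ _
    have hzD : z₀ ∈ closure D := by
      by_contra hzD
      have hdisj : Disjoint D (frontier (interior N)) := by
        refine disjoint_left.2 fun w hwD hwf => ?_
        obtain ⟨x, hxt, hwx⟩ := mem_iUnion₂.1 (ht hwf)
        have hDx : D = connectedComponentIn Q x :=
          (connectedComponentIn_eq hwD).trans (connectedComponentIn_eq hwx).symm
        rw [hDx] at hzD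
        have := mem_iInter₂.1 hy.2 x (Finset.mem_filter.2 ⟨hxt, hzD⟩)
        exact this (hDx ▸ subset_closure hyD)
      have hDN : D ⊆ interior N := by
        refine hDp.subset_left_of_subset_union isOpen_interior
          (isClosed_closure (s := interior N)).isOpen_compl
          (disjoint_compl_right.mono_left subset_closure) (fun w hw => ?_) ⟨y, hyD, hy.1⟩
        by_cases hwN : w ∈ closure (interior N)
        · left
          by_contra hwi
          exact disjoint_left.1 hdisj hw
            ⟨hwN, by rwa [isOpen_interior.interior_eq]⟩
        · exact Or.inr hwN
      have hclD : closure D ⊆ Q := fun w hw =>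
        ⟨hNO (hclN (closure_mono hDN hw)), fun hwz => hzD (by rwa [← mem_singleton_iff.1 hwz])⟩
      have hcl : closure D ⊆ D :=
        hDp.closure.subset_connectedComponentIn (subset_closure hyD) hclD
      have := IsClopen.eq_univ ⟨closure_subset_iff_isClosed.1 hcl, h Q hQo hzQ y⟩ ⟨y, hyD⟩
      exact hzQ (hDQ (this ▸ mem_univ z₀))
    have hins : IsPreconnected (insert z₀ D) :=
      hDp.subset_closure (subset_insert _ _) (insert_subset hzD subset_closure)
    exact hins.subset_connectedComponentIn (mem_insert _ _)
      (insert_subset hzO (hDQ.trans sdiff_subset)) (mem_insert_of_mem _ hyD)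
  rw [locallyConnectedSpace_iff_connectedComponentIn_open]
  intro F hF x _
  refine isOpen_iff_mem_nhds.2 fun y hy => ?_
  rw [connectedComponentIn_eq hy]
  have hyF : y ∈ F := connectedComponentIn_subset _ _ hy
  by_cases hyz : y = z₀
  · rw [hyz]
    exact hz F hF (hyz ▸ hyF)
  · refine Filter.mem_of_superset ((h (F \ {z₀}) (hF.sdiff isClosed_singleton) (fun h => h.2 rfl)
      y).mem_nhds (mem_connectedComponentIn ⟨hyF, hyz⟩)) (connectedComponentIn_mono y sdiff_subset)

/-! ### Connectedness in the one-point compactification -/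

section OnePoint

variable {Y : Type*} [TopologicalSpace Y]

theorem OnePoint.isPreconnected_compl_singleton_coe [T1Space Y] [NoncompactSpace Y] {y : Y}
    (h : IsPreconnected ({y}ᶜ : Set Y)) :
    IsPreconnected ({(y : OnePoint Y)}ᶜ : Set (OnePoint Y)) := by
  have h1 : IsPreconnected ((↑) '' ({y}ᶜ : Set Y) : Set (OnePoint Y)) :=
    h.image _ OnePoint.continuous_coe.continuousOn
  refine h1.subset_closure ?_ ?_
  · rintro _ ⟨z, hz, rfl⟩
    simpa using hz
  · intro z hz
    induction z using OnePoint.rec with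
    | coe z => exact subset_closure ⟨z, by simpa using hz, rfl⟩
    | infty =>
      rw [mem_closure_iff_nhds]
      intro t ht
      have ht' : t ∩ {(y : OnePoint Y)}ᶜ ∈ 𝓝 (OnePoint.infty : OnePoint Y) :=
        Filter.inter_mem ht (isClosed_singleton.isOpen_compl.mem_nhds hz)
      obtain ⟨w, ⟨hwt, hwy⟩, hw⟩ := Filter.nonempty_of_mem
        (Filter.inter_mem (mem_nhdsWithin_of_mem_nhds ht') (self_mem_nhdsWithin (s := {OnePoint.infty}ᶜ)))
      obtain ⟨v, rfl⟩ := OnePoint.ne_infty_iff_exists.1 hw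
      exact ⟨v, hwt, v, by simpa using hwy, rfl⟩

theorem OnePoint.isPreconnected_compl_infty [PreconnectedSpace Y] :
    IsPreconnected ({OnePoint.infty}ᶜ : Set (OnePoint Y)) := by
  rw [OnePoint.compl_infty]
  exact isPreconnected_range OnePoint.continuous_coe

theorem OnePoint.locallyConnectedSpace [T2Space Y] [LocallyCompactSpace Y] [PreconnectedSpace Y]
    [LocallyConnectedSpace Y] [NoncompactSpace Y] : LocallyConnectedSpace (OnePoint Y) := by
  refine locallyConnectedSpace_of_isOpen_connectedComponentIn OnePoint.infty fun O hO hinf x => ?_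
  refine isOpen_iff_mem_nhds.2 fun y hy => ?_
  rw [connectedComponentIn_eq hy]
  have hyO : y ∈ O := connectedComponentIn_subset _ _ hy
  obtain ⟨v, rfl⟩ := OnePoint.ne_infty_iff_exists.1 (fun h : y = OnePoint.infty => hinf (h ▸ hyO))
  have hO' : IsOpen ((↑) ⁻¹' O : Set Y) := hO.preimage OnePoint.continuous_coe
  have hv : v ∈ connectedComponentIn ((↑) ⁻¹' O : Set Y) v := mem_connectedComponentIn hyO
  refine Filter.mem_of_superset ((OnePoint.isOpenMap_coe _ hO'.connectedComponentIn).mem_nhds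
    (mem_image_of_mem _ hv)) ?_
  refine (isPreconnected_connectedComponentIn.image _
    OnePoint.continuous_coe.continuousOn).subset_connectedComponentIn (mem_image_of_mem _ hv) ?_
  exact image_subset_iff.2 (connectedComponentIn_subset _ _)

end OnePoint

/-! ### Closed connected sets that block three points -/

section Blocking

variable {Z : Type*} [TopologicalSpace Z]

/-- A set blocks three points if every connected set that is disjoint from it contains at most one
of them. -/
def Blocks (p : Fin 3 → Z) (C : Set Z) : Prop :=
  ∀ W, IsPreconnected W → Disjoint W C → ∀ i j, p i ∈ W → p j ∈ W → i = j

/-- A set that contains a closed connected blocking set. -/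
def HasBlocker (p : Fin 3 → Z) (U : Set Z) : Prop :=
  ∃ K, IsClosed K ∧ IsPreconnected K ∧ Blocks p K ∧ K ⊆ U

/-- A set all of whose open neighbourhoods contain a closed connected blocking set. -/
def IsBig (p : Fin 3 → Z) (A : Set Z) : Prop :=
  ∀ U, IsOpen U → A ⊆ U → HasBlocker p U

theorem IsBig.mono {p : Fin 3 → Z} {A B : Set Z} (hA : IsBig p A) (h : A ⊆ B) : IsBig p B :=
  fun U hU hBU => hA U hU (h.trans hBU)

theorem HasBlocker.mono {p : Fin 3 → Z} {A B : Set Z} (hA : HasBlocker p A) (h : A ⊆ B) :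
    HasBlocker p B := by
  obtain ⟨K, hK, hKp, hKb, hKA⟩ := hA
  exact ⟨K, hK, hKp, hKb, hKA.trans h⟩

theorem HasBlocker.isBig {p : Fin 3 → Z} {A : Set Z} (h : HasBlocker p A) : IsBig p A :=
  fun _ _ hU => h.mono hU

theorem IsOpen.isBig_iff {p : Fin 3 → Z} {U : Set Z} (hU : IsOpen U) :
    IsBig p U ↔ HasBlocker p U :=
  ⟨fun h => h U hU subset_rfl, HasBlocker.isBig⟩

/-- A connected blocking set inside a disjoint union of open sets lies in one of them; this is why
blockers are required to be connected. -/
theorem isBig_union_of_isOpen {p : Fin 3 → Z} {A B : Set Z} (hA : IsOpen A) (hB : IsOpen B)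
    (hd : Disjoint A B) (h : IsBig p (A ∪ B)) : IsBig p A ∨ IsBig p B := by
  obtain ⟨K, hK, hKp, hKb, hKU⟩ := h _ (hA.union hB) subset_rfl
  exact (hKp.subset_or_subset hA hB hd hKU).imp
    (fun h => HasBlocker.isBig ⟨K, hK, hKp, hKb, h⟩) (fun h => HasBlocker.isBig ⟨K, hK, hKp, hKb, h⟩)

theorem isBig_union_of_isClosed [NormalSpace Z] {p : Fin 3 → Z} {A B : Set Z} (hA : IsClosed A)
    (hB : IsClosed B) (hd : Disjoint A B) (h : IsBig p (A ∪ B)) : IsBig p A ∨ IsBig p B := by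
  by_contra hne
  simp only [IsBig, not_or, not_forall] at hne
  obtain ⟨⟨U, hU, hAU, hnU⟩, ⟨V, hV, hBV, hnV⟩⟩ := hne
  obtain ⟨U', V', hU', hV', hAU', hBV', hd'⟩ := normal_separation hA hB hd
  have h1 := h.mono (union_subset_union (subset_inter hAU hAU') (subset_inter hBV hBV'))
  rcases isBig_union_of_isOpen (hU.inter hU') (hV.inter hV')
    (hd'.mono inter_subset_right inter_subset_right) h1 with h2 | h2
  · exact hnU (h2 U hU inter_subset_left)
  · exact hnV (h2 V hV inter_subset_left)

theorem blocks_of_forall_mem {p : Fin 3 → Z} {C : Set Z} (h : ∀ i, p i ∈ C) : Blocks p C :=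
  fun _ _ hd i _ hi _ => absurd (h i) (disjoint_left.1 hd hi)

theorem Blocks.nonempty [PreconnectedSpace Z] {p : Fin 3 → Z} {C : Set Z} (h : Blocks p C) :
    C.Nonempty := by
  by_contra hne
  rw [not_nonempty_iff_eq_empty] at hne
  have := h univ isPreconnected_univ (by simp [hne]) 0 1 (mem_univ _) (mem_univ _)
  simp at this

variable [T2Space Z] [CompactSpace Z] [PreconnectedSpace Z] [LocallyConnectedSpace Z]

/-- If `C` and `K` were disjoint, the component `V` of `Cᶜ` containing `K` would hold at most one of
the three points because `C` blocks. Its complement is connected and misses `K`, so it would hold at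
most one as well: too few for three points. -/
theorem not_disjoint_of_blocks {p : Fin 3 → Z} {C K : Set Z} (hC : IsClosed C)
    (hCp : IsPreconnected C) (hCb : Blocks p C) (hKp : IsPreconnected K) (hKb : Blocks p K) :
    ¬ Disjoint C K := by
  intro hd
  obtain ⟨k, hk⟩ := hKb.nonempty
  set V := connectedComponentIn Cᶜ k with hV
  have hKV : K ⊆ V := hKp.subset_connectedComponentIn hk hd.subset_compl_left
  have h1 := hCb V isPreconnected_connectedComponentIn
    (disjoint_compl_left.mono_left (connectedComponentIn_subset _ _))
  have h2 := hKb Vᶜ (isPreconnected_compl_connectedComponentIn_compl hCp hC hCb.nonempty k)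
    (disjoint_compl_left.mono_right hKV)
  have h3 : ∀ i j, i ≠ j → (p i ∈ V ∧ p j ∈ Vᶜ) ∨ (p i ∈ Vᶜ ∧ p j ∈ V) := by
    intro i j hij
    by_cases hi : p i ∈ V <;> by_cases hj : p j ∈ V
    · exact absurd (h1 i j hi hj) hij
    · exact Or.inl ⟨hi, hj⟩
    · exact Or.inr ⟨hi, hj⟩
    · exact absurd (h2 i j hi hj) hij
  have a := h3 0 1 (by decide)
  have b := h3 0 2 (by decide)
  have c := h3 1 2 (by decide)
  simp only [mem_compl_iff] at a b c
  tauto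

theorem exists_isClosed_isBig {p : Fin 3 → Z} (A : OCSet Z) (h : IsBig p (A : Set Z)) :
    ∃ C, IsClosed C ∧ C ⊆ A ∧ IsBig p C := by
  rcases A.2 with hA | hA
  · obtain ⟨K, hK, hKp, hKb, hKA⟩ := hA.isBig_iff.1 h
    exact ⟨K, hK, hKA, HasBlocker.isBig ⟨K, hK, hKp, hKb, subset_rfl⟩⟩
  · exact ⟨A, hA, subset_rfl, h⟩

theorem not_isBig_of_disjoint {p : Fin 3 → Z} {A B : OCSet Z} (hd : Disjoint (A : Set Z) B)
    (hA : IsBig p (A : Set Z)) : ¬ IsBig p (B : Set Z) := by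
  intro hB
  obtain ⟨C, hC, hCA, hCb⟩ := exists_isClosed_isBig A hA
  obtain ⟨D, hD, hDB, hDb⟩ := exists_isClosed_isBig B hB
  obtain ⟨U, V, hU, hV, hCU, hDV, hUV⟩ := normal_separation hC hD (hd.mono hCA hDB)
  obtain ⟨K, hK, hKp, hKb, hKU⟩ := hCb U hU hCU
  obtain ⟨L, -, hLp, hLb, hLV⟩ := hDb V hV hDV
  exact not_disjoint_of_blocks hK hKp hKb hLp hLb (hUV.mono hKU hLV)

/-- In a space of genus zero, a finite family of closed solid sets that are nested or disjoint and
separate three points can be avoided by a closed connected blocking set. -/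
theorem exists_blocks_disjoint_of_laminar (hgenus : HasGenusZero Z) {p : Fin 3 → Z}
    (𝒮 : Finset (Set Z)) (hS : ∀ S ∈ 𝒮, IsClosed S ∧ IsSolidSet S)
    (hlam : ∀ S ∈ 𝒮, ∀ T ∈ 𝒮, S ⊆ T ∨ T ⊆ S ∨ Disjoint S T)
    (hsep : ∀ S ∈ 𝒮, ∀ i j, p i ∈ S → p j ∈ S → i = j) (hcov : ∀ i, ∃ S ∈ 𝒮, p i ∈ S) :
    ∃ K, IsClosed K ∧ IsPreconnected K ∧ Blocks p K ∧ Disjoint K (⋃ S ∈ 𝒮, S) := by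
  classical
  -- The maximal members are pairwise disjoint and have the same union, so genus zero applies to
  -- them.
  set M : Finset (Set Z) := 𝒮.filter (fun S => Maximal (· ∈ 𝒮) S) with hM
  have hMS : ∀ S ∈ M, S ∈ 𝒮 := fun S hS => (Finset.mem_filter.1 hS).1
  have hle : ∀ S ∈ 𝒮, ∃ T ∈ M, S ⊆ T := by
    intro S hS
    obtain ⟨T, hST, hT⟩ := 𝒮.exists_le_maximal hS
    exact ⟨T, Finset.mem_filter.2 ⟨hT.prop, hT⟩, hST⟩
  have hdisj : (M : Set (Set Z)).PairwiseDisjoint id := by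
    intro S hS T hT hne
    have hSm := (Finset.mem_filter.1 (Finset.mem_coe.1 hS)).2
    have hTm := (Finset.mem_filter.1 (Finset.mem_coe.1 hT)).2
    rcases hlam S hSm.prop T hTm.prop with h | h | h
    · exact absurd (h.antisymm (hSm.le_of_ge hTm.prop h)) hne
    · exact absurd ((hTm.le_of_ge hSm.prop h).antisymm h) hne
    · exact h
  have hG := hgenus M (fun S h => hS S (hMS S h)) hdisj
  have hclosed : IsClosed (⋃ S ∈ M, S) :=
    M.finite_toSet.isClosed_biUnion fun S h => (hS S (hMS S h)).1
  obtain ⟨N, hN, hNd⟩ := Set.PairwiseDisjoint.exists_mem_filter (l := fun S : Set Z => 𝓝ˢ S)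
    (t := (M : Set (Set Z))) (fun S h T h' hne => separatedNhds_iff_disjoint.1
      (normal_separation (hS S (hMS S h)).1 (hS T (hMS T h')).1 (hdisj h h' hne))) M.finite_toSet
  have hSN : ∀ S, S ⊆ interior (N S) := fun S => subset_interior_iff_mem_nhdsSet.2 (hN S)
  have hOd : (M : Set (Set Z)).PairwiseDisjoint fun S => interior (N S) :=
    hNd.mono fun S => interior_subset
  -- Because `K` contains everything outside the disjoint open neighbourhoods of the maximal sets, a
  -- connected set missing `K` stays in a single neighbourhood, which sees only the points `p i` of
  -- its own maximal set.
  obtain ⟨K, hKc, hKp, hOK, hKG⟩ := hG.exists_isCompact_isPreconnected_superset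
    hclosed.isOpen_compl (K := (⋃ S ∈ M, interior (N S))ᶜ)
    (isOpen_biUnion fun S _ => isOpen_interior).isClosed_compl.isCompact
    (compl_subset_compl.2 (iUnion₂_mono fun S _ => hSN S))
  refine ⟨K, hKc.isClosed, hKp, fun W hW hWK i j hi hj => ?_, ?_⟩
  · have hpt : ∀ i, ∃ S ∈ M, p i ∈ S := by
      intro i
      obtain ⟨S, hS, hiS⟩ := hcov i
      obtain ⟨T, hT, hST⟩ := hle S hS
      exact ⟨T, hT, hST hiS⟩
    obtain ⟨S, hSM, hiS⟩ := hpt i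
    obtain ⟨T, hTM, hjT⟩ := hpt j
    have hWO : W ⊆ ⋃ S ∈ M, interior (N S) := fun w hw => by
      by_contra h
      exact disjoint_left.1 hWK hw (hOK h)
    have hWS : W ⊆ interior (N S) := by
      refine hW.subset_left_of_subset_union isOpen_interior
        (v := ⋃ R ∈ M.erase S, interior (N R)) (isOpen_biUnion fun S _ => isOpen_interior) ?_ ?_
        ⟨p i, hi, hSN S hiS⟩
      · refine disjoint_iUnion₂_right.2 fun R hR => ?_
        exact hOd hSM (Finset.mem_of_mem_erase hR) (Finset.ne_of_mem_erase hR).symm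
      · refine hWO.trans (iUnion₂_subset fun R hR => ?_)
        by_cases hRS : R = S
        · rw [hRS]
          exact subset_union_left
        · exact (subset_biUnion_of_mem (u := fun R => interior (N R))
            (Finset.mem_erase.2 ⟨hRS, hR⟩)).trans subset_union_right
    have hST : S = T := by
      by_contra hne
      exact disjoint_left.1 (hOd hSM hTM hne) (hWS hj) (hSN T hjT)
    exact hsep S (hMS S hSM) i j hiS (hST ▸ hjT)
  · refine disjoint_left.2 fun w hwK hw => hKG hwK ?_
    obtain ⟨S, hS, hwS⟩ := mem_iUnion₂.1 hw
    obtain ⟨T, hT, hST⟩ := hle S hS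
    exact mem_biUnion hT (hST hwS)

/-- If a set does not block three points, a component of its complement contains two of them. -/
theorem exists_mem_connectedComponentIn_of_not_blocks {p : Fin 3 → Z} {D : Set Z} (h : ¬ Blocks p D) :
    ∃ i j, i ≠ j ∧ p i ∈ connectedComponentIn Dᶜ (p i) ∧ p j ∈ connectedComponentIn Dᶜ (p i) := by
  simp only [Blocks, not_forall] at h
  obtain ⟨W, hW, hWD, i, j, hi, hj, hij⟩ := h
  have hWV := hW.subset_connectedComponentIn hi hWD.subset_compl_right
  exact ⟨i, j, hij, hWV hi, hWV hj⟩

/-- For each nonblocking `D`, some component of `Dᶜ` contains two of the three points. Its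
complement is a solid hull of `D` containing at most one of them. Components chosen for different
`D` share one of the points, so the hulls are nested or disjoint, and the laminar case applies. -/
theorem exists_blocks_disjoint_of_finset (hgenus : HasGenusZero Z)
    (hcut : ∀ z : Z, IsPreconnected ({z}ᶜ : Set Z)) {p : Fin 3 → Z} (hp : Function.Injective p)
    (𝒟 : Finset (Set Z)) (hD : ∀ D ∈ 𝒟, IsClosed D ∧ IsPreconnected D ∧ D.Nonempty ∧ ¬ Blocks p D)
    (hdisj : ∀ D ∈ 𝒟, ∀ E ∈ 𝒟, D ≠ E → Disjoint D E) :
    ∃ K, IsClosed K ∧ IsPreconnected K ∧ Blocks p K ∧ Disjoint K (⋃ D ∈ 𝒟, D) := by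
  classical
  have hhull : ∀ D : Set Z, ∃ i : Fin 3, D ∈ 𝒟 → ∃ j, i ≠ j ∧
      p i ∈ connectedComponentIn Dᶜ (p i) ∧ p j ∈ connectedComponentIn Dᶜ (p i) := by
    intro D
    by_cases h : D ∈ 𝒟
    · obtain ⟨i, hi⟩ := exists_mem_connectedComponentIn_of_not_blocks (hD D h).2.2.2
      exact ⟨i, fun _ => hi⟩
    · exact ⟨0, fun h' => absurd h' h⟩
  choose ι hι using hhull
  set S : Set Z → Set Z := fun D => (connectedComponentIn Dᶜ (p (ι D)))ᶜ with hSdef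
  have hDS : ∀ D, D ⊆ S D := fun D => subset_compl_comm.1 (connectedComponentIn_subset _ _)
  -- Two pairs taken from three indices always intersect.
  have hfin : ∀ i j k l : Fin 3, i ≠ j → k ≠ l → i = k ∨ i = l ∨ j = k ∨ j = l := by decide
  have hmem : ∀ T ∈ 𝒟.image S ∪ Finset.univ.image (fun i => ({p i} : Set Z)),
      (∃ D ∈ 𝒟, S D = T) ∨ ∃ i, {p i} = T := by
    intro T hT
    simpa using hT
  -- The singletons `{p i}` are added so that the family covers all three points; they are solid
  -- because there are no cut points.
  have key : ∃ K, IsClosed K ∧ IsPreconnected K ∧ Blocks p K ∧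
      Disjoint K (⋃ T ∈ 𝒟.image S ∪ Finset.univ.image (fun i => ({p i} : Set Z)), T) := by
    refine exists_blocks_disjoint_of_laminar hgenus _ ?_ ?_ ?_ ?_
    · intro T hT
      obtain ⟨D, hD', rfl⟩ | ⟨i, rfl⟩ := hmem T hT
      · obtain ⟨h1, h2, h3, -⟩ := hD D hD'
        refine ⟨h1.isOpen_compl.connectedComponentIn.isClosed_compl,
          isPreconnected_compl_connectedComponentIn_compl h2 h1 h3 _, ?_⟩
        rw [compl_compl]
        exact isPreconnected_connectedComponentIn
      · exact ⟨isClosed_singleton, isPreconnected_singleton, hcut _⟩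
    · have hsing : ∀ (i : Fin 3) (T : Set Z), {p i} ⊆ T ∨ Disjoint {p i} T := fun i T => by
        by_cases h : p i ∈ T
        · exact Or.inl (singleton_subset_iff.2 h)
        · exact Or.inr (disjoint_singleton_left.2 h)
      intro T hT R hR
      obtain ⟨D, hD', rfl⟩ | ⟨i, rfl⟩ := hmem T hT
      · obtain ⟨E, hE', rfl⟩ | ⟨i, rfl⟩ := hmem R hR
        · by_cases hDE : D = E
          · exact Or.inl (hDE ▸ subset_rfl)
          obtain ⟨j, hij, hi, hj⟩ := hι D hD'
          obtain ⟨l, hkl, hk, hl⟩ := hι E hE'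
          have hq : ∃ q, q ∈ connectedComponentIn Dᶜ (p (ι D)) ∧
              q ∈ connectedComponentIn Eᶜ (p (ι E)) := by
            rcases hfin _ _ _ _ hij hkl with h | h | h | h
            · exact ⟨_, hi, h ▸ hk⟩
            · exact ⟨_, hi, h ▸ hl⟩
            · exact ⟨_, hj, h ▸ hk⟩
            · exact ⟨_, hj, h ▸ hl⟩
          obtain ⟨q, hqD, hqE⟩ := hq
          exact compl_connectedComponentIn_nested_or_disjoint (hD D hD').2.1 (hD D hD').1
            (hD D hD').2.2.1 (hD E hE').2.1 (hdisj D hD' E hE' hDE) hqD hqE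
        · exact Or.inr ((hsing i (S D)).imp id fun h => h.symm)
      · exact (hsing i R).imp id Or.inr
    · intro T hT k l hk hl
      obtain ⟨D, hD', rfl⟩ | ⟨i, rfl⟩ := hmem T hT
      · obtain ⟨j, hij, hi, hj⟩ := hι D hD'
        by_contra hkl
        rcases hfin _ _ _ _ hij hkl with h | h | h | h
        · exact hk (h ▸ hi)
        · exact hl (h ▸ hi)
        · exact hk (h ▸ hj)
        · exact hl (h ▸ hj)
      · exact hp ((mem_singleton_iff.1 hk).trans (mem_singleton_iff.1 hl).symm)
    · intro i
      exact ⟨{p i}, Finset.mem_union_right _ (Finset.mem_image_of_mem _ (Finset.mem_univ i)), rfl⟩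
  obtain ⟨K, hK, hKp, hKb, hKd⟩ := key
  refine ⟨K, hK, hKp, hKb, hKd.mono_right (iUnion₂_subset fun D hD => (hDS D).trans ?_)⟩
  exact subset_biUnion_of_mem (u := fun T : Set Z => T)
    (Finset.mem_union_left _ (Finset.mem_image_of_mem S hD))

/-- Some neighbourhood `U` of `F` contains no blocker, so the disjoint compact connected sets
covering `F` inside `U` do not block. A blocker avoiding all of them lies in `Fᶜ`. -/
theorem isBig_compl_of_not_isBig (hgenus : HasGenusZero Z)
    (hcut : ∀ z : Z, IsPreconnected ({z}ᶜ : Set Z)) {p : Fin 3 → Z} (hp : Function.Injective p)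
    {F : Set Z} (hF : IsClosed F) (h : ¬ IsBig p F) : IsBig p Fᶜ := by
  simp only [IsBig, not_forall] at h
  obtain ⟨U, hU, hFU, hn⟩ := h
  obtain ⟨𝒟, h𝒟, hdisj, hF𝒟⟩ := hF.isCompact.exists_finset_isPreconnected_cover hU hFU
  obtain ⟨K, hK, hKp, hKb, hKd⟩ := exists_blocks_disjoint_of_finset hgenus hcut hp 𝒟
    (fun D hD => ⟨(h𝒟 D hD).1.isClosed, (h𝒟 D hD).2.1, (h𝒟 D hD).2.2.1,
      fun hb => hn ⟨D, (h𝒟 D hD).1.isClosed, (h𝒟 D hD).2.1, hb, (h𝒟 D hD).2.2.2⟩⟩) hdisj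
  exact HasBlocker.isBig ⟨K, hK, hKp, hKb, (hKd.mono_right hF𝒟).subset_compl_right⟩

/-- Two of the points differ from `z` and are joined by a compact connected `L` missing `z`. A
blocker inside the neighbourhood `Lᶜ` of `z` would have to separate them. -/
theorem not_isBig_singleton (hcut : ∀ z : Z, IsPreconnected ({z}ᶜ : Set Z)) {p : Fin 3 → Z}
    (hp : Function.Injective p) (z : Z) : ¬ IsBig p {z} := by
  intro h
  have hij : ∃ i j, i ≠ j ∧ p i ≠ z ∧ p j ≠ z := by
    by_cases h0 : p 0 = z
    · exact ⟨1, 2, by decide, fun h1 => absurd (hp (h1.trans h0.symm)) (by decide),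
        fun h1 => absurd (hp (h1.trans h0.symm)) (by decide)⟩
    · by_cases h1 : p 1 = z
      · exact ⟨0, 2, by decide, h0, fun h2 => absurd (hp (h2.trans h1.symm)) (by decide)⟩
      · exact ⟨0, 1, by decide, h0, h1⟩
  obtain ⟨i, j, hij, hi, hj⟩ := hij
  obtain ⟨L, hLc, hLp, hpL, hLz⟩ := (hcut z).exists_isCompact_isPreconnected_superset
    isClosed_singleton.isOpen_compl (K := {p i, p j}) (Set.toFinite _).isCompact
    (insert_subset hi (singleton_subset_iff.2 hj))
  obtain ⟨K, -, -, hKb, hKL⟩ := h Lᶜ hLc.isClosed.isOpen_compl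
    (singleton_subset_iff.2 fun hz => hLz hz rfl)
  exact hij (hKb L hLp (disjoint_compl_right.mono_right hKL) i j (hpL (by simp)) (hpL (by simp)))

/-- When one set is closed and the other open, complementation reduces to two sets of the same type:
for open `C` one splits `Bᶜ = A ∪ Cᶜ` into closed sets, for closed `C` one splits `Aᶜ = B ∪ Cᶜ` into
open sets. In both cases `Cᶜ` is not big because `C` is. -/
theorem isBig_union_iff (hgenus : HasGenusZero Z)
    (hcut : ∀ z : Z, IsPreconnected ({z}ᶜ : Set Z)) {p : Fin 3 → Z} (hp : Function.Injective p)
    {A B C : OCSet Z} (hd : Disjoint (A : Set Z) B) (hC : (C : Set Z) = (A : Set Z) ∪ B) :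
    IsBig p (C : Set Z) ↔ IsBig p (A : Set Z) ∨ IsBig p (B : Set Z) := by
  refine ⟨fun h => ?_, fun h => ?_⟩
  swap
  · rw [hC]
    exact h.elim (fun h => h.mono subset_union_left) (fun h => h.mono subset_union_right)
  have hcompl : ∀ D : OCSet Z, ¬ IsBig p (D : Set Z) → IsBig p (D : Set Z)ᶜ := by
    rintro ⟨D, hD | hD⟩ hn
    · by_contra h'
      have := isBig_compl_of_not_isBig hgenus hcut hp hD.isClosed_compl h'
      rw [compl_compl] at this
      exact hn this
    · exact isBig_compl_of_not_isBig hgenus hcut hp hD hn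
  have hmixed : ∀ A B C : OCSet Z, Disjoint (A : Set Z) B → (C : Set Z) = (A : Set Z) ∪ B →
      IsBig p (C : Set Z) → IsClosed (A : Set Z) → IsOpen (B : Set Z) →
      IsBig p (A : Set Z) ∨ IsBig p (B : Set Z) := by
    intro A B C hd hC h hA hB
    have hCn : ¬ IsBig p (C : Set Z)ᶜ := fun h' =>
      not_isBig_of_disjoint (A := C)
        (B := ⟨(C : Set Z)ᶜ, C.2.symm.imp (fun h => h.isOpen_compl) (fun h => h.isClosed_compl)⟩)
        disjoint_compl_right h h'
    by_contra hne
    rw [not_or] at hne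
    have hAC : Disjoint (A : Set Z) (C : Set Z)ᶜ :=
      disjoint_compl_right.mono_left (hC ▸ subset_union_left)
    have hBC : Disjoint (B : Set Z) (C : Set Z)ᶜ :=
      disjoint_compl_right.mono_left (hC ▸ subset_union_right)
    rcases C.2 with hCo | hCc
    · have h1 := hcompl B hne.2
      have h2 : (B : Set Z)ᶜ = (A : Set Z) ∪ (C : Set Z)ᶜ := by
        ext x
        have : x ∈ (A : Set Z) → x ∉ (B : Set Z) := fun h => disjoint_left.1 hd h
        simp only [hC, mem_compl_iff, mem_union]
        tauto
      rw [h2] at h1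
      rcases isBig_union_of_isClosed hA hCo.isClosed_compl hAC h1 with h3 | h3
      · exact hne.1 h3
      · exact hCn h3
    · have h1 := hcompl A hne.1
      have h2 : (A : Set Z)ᶜ = (B : Set Z) ∪ (C : Set Z)ᶜ := by
        ext x
        have : x ∈ (A : Set Z) → x ∉ (B : Set Z) := fun h => disjoint_left.1 hd h
        simp only [hC, mem_compl_iff, mem_union]
        tauto
      rw [h2] at h1
      rcases isBig_union_of_isOpen hB hCc.isOpen_compl hBC h1 with h3 | h3
      · exact hne.2 h3
      · exact hCn h3
  rcases A.2 with hA | hA <;> rcases B.2 with hB | hB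
  · exact isBig_union_of_isOpen hA hB hd (hC ▸ h)
  · exact (hmixed B A C hd.symm (by rw [hC, union_comm]) h hB hA).symm
  · exact hmixed A B C hd hC h hA hB
  · exact isBig_union_of_isClosed hA hB hd (hC ▸ h)

end Blocking

namespace DTM

/-! ### The topological measure of three points -/

section ThreePoints

variable {Z : Type*} [TopologicalSpace Z] [T2Space Z] [CompactSpace Z] [PreconnectedSpace Z]
  [LocallyConnectedSpace Z]

open Classical in
/-- The set function with values `0` and `1` that is determined by three points. -/
noncomputable def threePoints (p : Fin 3 → Z) : DTM Z where
  toFun A := if IsBig p (A : Set Z) then 1 else 0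
  add_compact C K h := by
    have hiff : IsBig p ((C : Set Z) ∪ K) ↔ IsBig p (C : Set Z) ∨ IsBig p (K : Set Z) :=
      ⟨isBig_union_of_isClosed C.isCompact.isClosed K.isCompact.isClosed h, fun h =>
        h.elim (fun h => h.mono subset_union_left) (fun h => h.mono subset_union_right)⟩
    have hn := not_isBig_of_disjoint (p := p) (A := OCSet.ofCompact C) (B := OCSet.ofCompact K) h
    simp only [OCSet.ofCompact, Compacts.coe_sup, hiff] at hn ⊢
    by_cases h1 : IsBig p (C : Set Z)
    · simp [h1, hn h1]
    · by_cases h2 : IsBig p (K : Set Z) <;> simp [h1, h2]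
  inner_regular U := by
    refine le_antisymm ?_ (iSup₂_le fun K hK => ?_)
    · by_cases h : IsBig p (U : Set Z)
      · obtain ⟨K, hK, hKp, hKb, hKU⟩ := U.isOpen.isBig_iff.1 h
        refine le_iSup₂_of_le (⟨K, hK.isCompact⟩ : Compacts Z) hKU ?_
        have hb : IsBig p K := HasBlocker.isBig ⟨K, hK, hKp, hKb, subset_rfl⟩
        simp [OCSet.ofCompact, hb]
        split_ifs <;> simp
      · simp [OCSet.ofOpen, h]
    · by_cases h : IsBig p (K : Set Z)
      · simp [OCSet.ofCompact, OCSet.ofOpen, h, h.mono hK]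
      · simp [OCSet.ofCompact, h]
  outer_regular F := by
    refine le_antisymm (le_iInf₂ fun U hU => ?_) ?_
    · by_cases h : IsBig p (F : Set Z)
      · simp [OCSet.ofClosed, OCSet.ofOpen, h, h.mono hU]
      · simp [OCSet.ofClosed, h]
    · by_cases h : IsBig p (F : Set Z)
      · refine iInf₂_le_of_le ⊤ (by simp) ?_
        simp [OCSet.ofClosed, h]
        split_ifs <;> simp
      · have h' := h
        simp only [IsBig, not_forall] at h'
        obtain ⟨U, hU, hFU, hn⟩ := h'
        refine iInf₂_le_of_le (⟨U, hU⟩ : Opens Z) hFU ?_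
        simp [OCSet.ofOpen, hU.isBig_iff, hn]
  finite := by split_ifs <;> simp

open Classical in
theorem threePoints_apply (p : Fin 3 → Z) (A : OCSet Z) :
    threePoints p A = if IsBig p (A : Set Z) then 1 else 0 := rfl

theorem isTopologicalMeasure_threePoints (hgenus : HasGenusZero Z)
    (hcut : ∀ z : Z, IsPreconnected ({z}ᶜ : Set Z)) {p : Fin 3 → Z} (hp : Function.Injective p) :
    (threePoints p).IsTopologicalMeasure := by
  intro A B C hd hC _ _ _
  have hiff := isBig_union_iff hgenus hcut hp hd hC
  have hn := not_isBig_of_disjoint (p := p) hd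
  simp only [threePoints_apply]
  by_cases h1 : IsBig p (A : Set Z)
  · simp [h1, hn h1, hiff.2 (Or.inl h1)]
  · by_cases h2 : IsBig p (B : Set Z)
    · simp [h1, h2, hiff.2 (Or.inr h2)]
    · have h3 : ¬ IsBig p (C : Set Z) := fun h => (hiff.1 h).elim h1 h2
      simp [h1, h2, h3]

/-- On an open subspace of a compact, connected, locally connected space of genus zero without cut
points, there are proper topological measures of mass one concentrated arbitrarily close to any
given point. -/
theorem exists_proper_topologicalMeasure_concentrated [Nontrivial Z] (hgenus : HasGenusZero Z)
    (hcut : ∀ z : Z, IsPreconnected ({z}ᶜ : Set Z)) {Y : Type*} [TopologicalSpace Y] [T2Space Y]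
    [MeasurableSpace Y] [BorelSpace Y] {e : Y → Z} (he : IsOpenEmbedding e) {x : Y} {U : Set Y}
    (hU : U ∈ 𝓝 x) :
    ∃ ν ∈ properTM Y, ν (OCSet.whole Y) = 1 ∧
      ∃ K : Compacts Y, (K : Set Y) ⊆ U ∧ ν (OCSet.ofCompact K) = 1 := by
  have hWo : IsOpen (e '' interior U) := he.isOpenMap _ isOpen_interior
  have hxW : e x ∈ e '' interior U := mem_image_of_mem _ (mem_interior_iff_mem_nhds.2 hU)
  set V := connectedComponentIn (e '' interior U) (e x) with hV
  have hVo : IsOpen V := hWo.connectedComponentIn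
  have hVp : IsPreconnected V := isPreconnected_connectedComponentIn
  have hxV : e x ∈ V := mem_connectedComponentIn hxW
  have hVW : V ⊆ e '' interior U := connectedComponentIn_subset _ _
  -- A one-point component would be clopen in a connected space with several points. Being connected
  -- and nontrivial, `V` is infinite and supplies the three points.
  have hVn : V.Nontrivial := by
    by_contra h
    have hV1 : V = {e x} := (not_nontrivial_iff.1 h).eq_singleton_of_mem hxV
    have huniv := IsClopen.eq_univ ⟨hV1 ▸ isClosed_singleton, hVo⟩ ⟨e x, hxV⟩
    obtain ⟨z, hz⟩ := exists_ne (e x)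
    exact hz (mem_singleton_iff.1 (hV1 ▸ huniv ▸ mem_univ z))
  have hVi := hVp.infinite_of_nontrivial hVn
  set p : Fin 3 → Z := fun i => hVi.natEmbedding V i with hpdef
  have hp : Function.Injective p := fun i j h =>
    Fin.ext ((hVi.natEmbedding V).injective (Subtype.ext h))
  obtain ⟨L, hLc, hLp, hpL, hLV⟩ := hVp.exists_isCompact_isPreconnected_superset hVo
    (K := range p) (finite_range p).isCompact
    (range_subset_iff.2 fun i => (hVi.natEmbedding V i).2)
  have hLr : L ⊆ range e := (hLV.trans hVW).trans (image_subset_range _ _)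
  have hLblk : HasBlocker p L := ⟨L, hLc.isClosed, hLp,
    blocks_of_forall_mem fun i => hpL (mem_range_self i), subset_rfl⟩
  have hLbig : IsBig p L := hLblk.isBig
  refine ⟨comap he (threePoints p),
    ⟨(isTopologicalMeasure_threePoints hgenus hcut hp).comap he, ?_⟩, ?_,
    ⟨e ⁻¹' L, he.isInducing.isCompact_preimage' hLc hLr⟩, ?_, ?_⟩
  · intro m _ hle
    -- Singletons are not big, so each point has an open neighbourhood of mass zero. A Radon measure
    -- below is locally null, hence null on compact sets and therefore zero.
    have hloc : ∀ y : Y, ∃ N ∈ 𝓝 y, m N = 0 := by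
      intro y
      have hy := not_isBig_singleton hcut hp (e y)
      simp only [IsBig, not_forall] at hy
      obtain ⟨O, hO, hyO, hn⟩ := hy
      have hOe : IsOpen (e ⁻¹' O) := hO.preimage he.continuous
      refine ⟨e ⁻¹' O, hOe.mem_nhds (hyO rfl), le_antisymm ?_ zero_le⟩
      refine (hle (OCSet.ofOpen ⟨e ⁻¹' O, hOe⟩)).trans ?_
      rw [comap_ofOpen, threePoints_apply, if_neg]
      exact fun h => hn ((h.mono (image_preimage_subset e O)) O hO subset_rfl)
    have hK : ∀ K : Set Y, IsCompact K → m K = 0 := fun K hK =>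
      hK.measure_zero_of_nhdsWithin fun y _ => by
        obtain ⟨N, hN, h0⟩ := hloc y
        exact ⟨N, mem_nhdsWithin_of_mem_nhds hN, h0⟩
    refine Measure.measure_univ_eq_zero.1 ?_
    rw [isOpen_univ.measure_eq_iSup_isCompact]
    simp only [ENNReal.iSup_eq_zero]
    exact fun K _ hKc => hK K hKc
  · refine (comap_ofOpen he _ ⊤).trans ?_
    rw [threePoints_apply, if_pos]
    refine hLbig.mono ?_
    simpa [OCSet.ofOpen] using hLr
  · intro y hy
    obtain ⟨w, hw, hwy⟩ := hVW (hLV hy)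
    exact he.injective hwy ▸ interior_subset hw
  · rw [comap_ofCompact, threePoints_apply, if_pos]
    refine hLbig.mono ?_
    exact (image_preimage_eq_of_subset hLr).ge

end ThreePoints

end DTM

/-! ### From point masses to Radon measures -/

namespace DTM

section PointMasses

variable {X : Type*} [TopologicalSpace X] [T2Space X]

/-- The values of all nonnegative functions that vanish at infinity at a given point. -/
def evaluation (x : X) : TestFunction X → ℝ := fun f => f.1 x

theorem evaluation_mem_closure {S : Set (DTM X)} {x : X}
    (h : ∀ U ∈ 𝓝 x, ∃ ν ∈ S, ν (OCSet.whole X) = 1 ∧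
      ∃ K : Compacts X, (K : Set X) ⊆ U ∧ ν (OCSet.ofCompact K) = 1) :
    evaluation x ∈ closure (pairing '' S) := by
  rw [mem_closure_iff_nhds]
  intro t ht
  rw [nhds_pi, Filter.mem_pi] at ht
  obtain ⟨I, hI, s, hs, hst⟩ := ht
  choose ε hε hεs using fun f => Metric.mem_nhds_iff.1 (hs f)
  have hU : ⋂ f ∈ I, {y | |f.1 y - f.1 x| < ε f / 2} ∈ 𝓝 x := by
    refine (Filter.biInter_mem hI).2 fun f _ => ?_
    have hc : Continuous fun y => |f.1 y - f.1 x| :=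
      ((map_continuous f.1).sub continuous_const).abs
    exact (isOpen_lt hc continuous_const).mem_nhds (by simpa using half_pos (hε f))
  obtain ⟨ν, hν, h1, K, hKU, hK⟩ := h _ hU
  refine ⟨pairing ν, hst fun f hf => hεs f ?_, ν, hν, rfl⟩
  have := abs_quasiIntegral_sub_le h1 hK (f.2 x) fun y hy => mem_iInter₂.1 (hKU hy) f hf
  rw [Metric.mem_ball, Real.dist_eq]
  exact this.trans_lt (half_lt_self (hε f))

/-- A convex cone of set functions whose closure contains the point masses is dense in the finite
Radon measures. -/
theorem finiteM_subset_closure_of_evaluation [MeasurableSpace X] [BorelSpace X] {S : Set (DTM X)}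
    (h0 : 0 ∈ S) (hadd : ∀ μ ∈ S, ∀ ν ∈ S, μ + ν ∈ S)
    (hsmul : ∀ c : NNReal, ∀ μ ∈ S, c • μ ∈ S)
    (h : ∀ x : X, evaluation x ∈ closure (pairing '' S)) : finiteM X ⊆ closure S := by
  rintro μ ⟨m, hfin, -, hμ⟩
  rw [mem_closure_iff_pairing, mem_closure_iff_nhds]
  intro t ht
  rw [nhds_pi, Filter.mem_pi] at ht
  obtain ⟨I, hI, s, hs, hst⟩ := ht
  have := hI.fintype
  -- A basic neighbourhood involves finitely many test functions. Projecting to these coordinates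
  -- puts the integral of the point evaluations in a finite-dimensional space, where averages stay
  -- in closed convex sets.
  let R : (TestFunction X → ℝ) → (I → ℝ) := fun φ f => φ f.1
  have hR : Continuous R := continuous_pi fun f => continuous_apply _
  set A : Set (I → ℝ) := R '' (pairing '' S) with hA
  have hconv : Convex ℝ (closure A) := by
    refine Convex.closure ?_
    rintro _ ⟨_, ⟨μ, hμ, rfl⟩, rfl⟩ _ ⟨_, ⟨ν, hν, rfl⟩, rfl⟩ a b ha hb -
    lift a to NNReal using ha
    lift b to NNReal using hb
    refine ⟨_, ⟨a • μ + b • ν, hadd _ (hsmul a μ hμ) _ (hsmul b ν hν), rfl⟩, ?_⟩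
    rw [pairing_add, pairing_smul, pairing_smul]
    rfl
  have hscale : ∀ c : ℝ, 0 ≤ c → ∀ φ ∈ closure A, c • φ ∈ closure A := by
    intro c hc φ hφ
    lift c to NNReal using hc
    refine map_mem_closure (continuous_const_smul (c : ℝ)) hφ ?_
    rintro _ ⟨_, ⟨μ, hμ, rfl⟩, rfl⟩
    refine ⟨_, ⟨c • μ, hsmul c μ hμ, rfl⟩, ?_⟩
    rw [pairing_smul]
    rfl
  have hmem : ∀ x, R (evaluation x) ∈ closure A := fun x =>
    map_mem_closure hR (h x) fun φ hφ => mem_image_of_mem R hφ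
  have hint : Integrable (fun x => R (evaluation x)) m :=
    Integrable.of_eval fun f => f.1.1.integrable_of_isFiniteMeasure m
  have hRμ : R (pairing μ) = ∫ x, R (evaluation x) ∂m := by
    funext f
    rw [eval_integral (fun f => f.1.1.integrable_of_isFiniteMeasure m)]
    exact quasiIntegral_eq_integral (fun U => hμ (OCSet.ofOpen U)) f.1.2
  have hRA : R (pairing μ) ∈ closure A := by
    rw [hRμ]
    rcases eq_or_ne m 0 with rfl | hm
    · rw [integral_zero_measure]
      refine subset_closure ⟨_, ⟨0, h0, rfl⟩, ?_⟩
      rw [pairing_zero]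
      rfl
    · have : NeZero m := ⟨hm⟩
      -- The integral is the total mass times the average: the average lies in the closed convex
      -- set, and the multiple does because the set is a cone.
      rw [← measure_smul_average]
      exact hscale _ measureReal_nonneg _ (hconv.average_mem isClosed_closure
        (Filter.Eventually.of_forall hmem) hint)
  obtain ⟨_, hψ, _, ⟨ν, hν, rfl⟩, rfl⟩ := mem_closure_iff_nhds.1 hRA
    (univ.pi fun f : I => s f.1) (set_pi_mem_nhds finite_univ fun f _ => hs f.1)
  exact ⟨pairing ν, hst fun f hf => hψ ⟨f, hf⟩ (mem_univ _), ν, hν, rfl⟩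

end PointMasses

/-- The proper topological measures of mass one near a given point of a space of genus zero. -/
theorem exists_properTM_of_isGenusZeroNoCutPoints {Y : Type*} [TopologicalSpace Y] [T2Space Y]
    [MeasurableSpace Y] [BorelSpace Y] (hY : IsGenusZeroNoCutPoints Y) {x : Y} {U : Set Y}
    (hU : U ∈ 𝓝 x) :
    ∃ ν ∈ properTM Y, ν (OCSet.whole Y) = 1 ∧
      ∃ K : Compacts Y, (K : Set Y) ⊆ U ∧ ν (OCSet.ofCompact K) = 1 := by
  have := hY.nontrivial
  have := hY.connected
  have := hY.locallyConnected
  have := hY.locallyCompact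
  by_cases hc : CompactSpace Y
  · exact exists_proper_topologicalMeasure_concentrated (hY.genus_zero.1 hc)
      (fun z => (hY.no_cut_point z).isPreconnected) IsOpenEmbedding.id hU
  · have : NoncompactSpace Y := not_compactSpace_iff.1 hc
    have := OnePoint.locallyConnectedSpace (Y := Y)
    have : Nontrivial (OnePoint Y) := (OnePoint.coe_injective (X := Y)).nontrivial
    refine exists_proper_topologicalMeasure_concentrated (hY.genus_zero.2 hc) (fun z => ?_)
      OnePoint.isOpenEmbedding_coe hU
    induction z using OnePoint.rec with
    | infty => exact OnePoint.isPreconnected_compl_infty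
    | coe z =>
      exact OnePoint.isPreconnected_compl_singleton_coe (hY.no_cut_point z).isPreconnected

/-! ### Density in the Radon measures for genus zero pieces -/

section Families

variable {X : Type*} [TopologicalSpace X] [T2Space X] [MeasurableSpace X] [BorelSpace X]

theorem zero_mem_properTM : (0 : DTM X) ∈ properTM X :=
  ⟨IsTopologicalMeasure.zero, IsProper.zero⟩

theorem add_mem_properTM (μ : DTM X) (hμ : μ ∈ properTM X) (ν : DTM X) (hν : ν ∈ properTM X) :
    μ + ν ∈ properTM X := ⟨hμ.1.add hν.1, hμ.2.add hν.2⟩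

theorem finiteM_subset_closure_properTM {Xi : ℕ → Set X} (hcover : ⋃ i, Xi i = univ)
    (hc : ∀ i, IsClosed (Xi i)) (hg : ∀ i, IsGenusZeroNoCutPoints (Xi i)) :
    finiteM X ⊆ closure (properTM X) := by
  refine finiteM_subset_closure_of_evaluation zero_mem_properTM add_mem_properTM
    (fun c μ hμ => ⟨hμ.1.smul c, hμ.2.smul c⟩) fun x => evaluation_mem_closure fun U hU => ?_
  obtain ⟨i, hi⟩ := mem_iUnion.1 (hcover ▸ mem_univ x)
  have he := (hc i).isClosedEmbedding_subtypeVal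
  obtain ⟨ν, hν, h1, K, hKU, hK⟩ := exists_properTM_of_isGenusZeroNoCutPoints (hg i)
    (x := ⟨x, hi⟩) (he.continuous.continuousAt.preimage_mem_nhds hU)
  refine ⟨push he ν, ⟨hν.1.push he, hν.2.push he⟩, h1, K.map _ he.continuous,
    image_subset_iff.2 hKU, ?_⟩
  rw [← hK, push_apply]
  congr 1
  exact Subtype.ext (preimage_image_eq _ he.injective)

end Families

end DTM

open DTM

theorem mainTheorem11 {X : Type*} [TopologicalSpace X] [T2Space X] [LocallyCompactSpace X]
    [MeasurableSpace X] [BorelSpace X] (Xi : ℕ → Set X) (hcover : ⋃ i, Xi i = univ) :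
    ((∀ i, IsCompact (Xi i)) →
      (((∀ i, finiteM (Xi i) ⊆ closure (properDTM (Xi i))) →
          finiteM X ⊆ closure (properDTM X)) ∧
        ((∀ i, finiteM (Xi i) ⊆ closure (properTM (Xi i))) →
          finiteM X ⊆ closure (properTM X)))) ∧
    ((∀ i, IsClosed (Xi i)) → (∀ i, IsGenusZeroNoCutPoints (Xi i)) →
      (finiteTM X ⊆ closure (properTM X) ∧ univ ⊆ closure (properDTM X))) := by
  have hD0 : (0 : DTM X) ∈ properDTM X := IsProper.zero
  have hDadd : ∀ μ ∈ properDTM X, ∀ ν ∈ properDTM X, μ + ν ∈ properDTM X :=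
    fun μ hμ ν hν => IsProper.add hμ hν
  refine ⟨fun hc => ⟨fun h => ?_, fun h => ?_⟩, fun hc hg => ⟨fun μ hμ => ?_, fun μ _ => ?_⟩⟩
  · exact finiteM_subset_closure_of_iUnion hcover (fun i => (hc i).isClosed) hD0 hDadd h
      fun i ν hν => IsProper.push _ hν
  · exact finiteM_subset_closure_of_iUnion hcover (fun i => (hc i).isClosed) zero_mem_properTM
      add_mem_properTM h fun i ν hν => ⟨hν.1.push _, hν.2.push _⟩
  · obtain ⟨ρ, hρ, ν, hν, hTM, heq⟩ := exists_measure_add_proper μ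
    rw [← mem_pairingClosure (h0 := zero_mem_properTM) (hadd := add_mem_properTM), heq]
    exact add_mem (mem_pairingClosure.2 (finiteM_subset_closure_properTM hcover hc hg hρ))
      (mem_pairingClosure.2 (subset_closure ⟨hTM hμ, hν⟩))
  · obtain ⟨ρ, hρ, ν, hν, -, heq⟩ := exists_measure_add_proper μ
    rw [← mem_pairingClosure (h0 := hD0) (hadd := hDadd), heq]
    exact add_mem (mem_pairingClosure.2 (closure_mono (fun _ h => h.2)
      (finiteM_subset_closure_properTM hcover hc hg hρ))) (mem_pairingClosure.2 (subset_closure hν))
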